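/- Let $\Omega$ be a finite set of world states and $\Delta(\Omega)$ the set of beliefs (probability distributions on $\Omega$) with the total variation metric. An experiment is a finitely supported probability distribution $e=(\lambda_j,p_j)_{j\in[m]}$ on $\Delta(\Omega)$ ($\lambda_j>0$, the $p_j$ distinct), with support $\tau(e)=\{p_1,\dots,p_m\}$ and mean $\sigma(e)=\sum_j\lambda_jp_j$; it spreads $\sigma(e)$, and it is trivial if $m=1$. Let $F_0$ be the set of all experiments and $T$ the set of trivial ones. Let $\mu\in\Delta(\Omega)$, let $T\subseteq F\subseteq F_0$, put $\mathcal F(p)=\{e\in F:\sigma(e)=p\}$, and let $v:\Delta(\Omega)\to[0,\infty)$ be upper semicontinuous. Assume: * (Assumption 1) there is $h\in\mathbb N$ with $|\tau(e)|\le h$ for all $e\in F$, and every Borel probability measure on $\Delta(\Omega)$ that is the weak limit of a sequence in $F$ belongs to $F$; * (Assumption 2) there is $\delta>0$ such that $\sum_j\lambda_jH(p_j)\le H(\sigma(e))-\delta$ for every $e=(\lambda_j,p_j)_{j\in[m]}\in F\setminus T$, where $H(p)=-\sum_{\omega}p(\omega)\log p(\omega)$. A sequential persuasion from $\mu$ ($n$-step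 or infinite) starts at the belief $\mu$ and, at each of its steps, chooses, depending on the whole history $\xi=(p_0,e_1,p_1,\dots,e_i,p_i)$ of past experiments and beliefs, an experiment in $\mathcal F(p_i)$, whose random outcome is the next belief. Let $\Xi_n$ be the finite set of $n$-step histories that can occur, $\Pr[\xi]=\prod_je_j(p_j)$, $\mathrm{last}(\xi)=p_n$, and $b_n$ the random belief after $n$ steps. An infinite sequential persuasion $S$ terminates after $\xi$ if it chooses the trivial experiment at $\xi$ and at all later steps, and its value is $$\mathcal V(S)=\sup_{n}\ \sum_{\xi\in\Xi_n,\ S\text{ terminates after }\xi}\Pr[\xi]\,v(\mathrm{last}(\xi)).$$ Let $\hat v(p)=\max\{\sum_j\lambda_jv(p_j):(\lambda_j,p_j)_{j\in[m]}\in F_0,\ \sum_j\lambda_jp_j=p\}$. Call $O\subseteq\Delta(\Omega)$ an optimal-support set for $(v,\mu)$ if $\mu\in\mathrm{conv}(O)$ and, for every $p\in\mathrm{conv}(O)$ and every $e=(\lambda_j,p_j)_{j\in[m]}\in F_0$ with $\sigma(e)=p$, we have $\sum_j\lambda_jv(p_j)=\hat v(p)$ if and only if $\tau(e)\subseteq O$.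 Then an optimal-support set for $(v,\mu)$ exists, and for every such set $O$ the following are equivalent: 1. $O$ is implementable: for every $\epsilon>0$ there are $n\in\mathbb N$ and an $n$-step sequential persuasion from $\mu$ with $\Pr[b_n\in O]>1-\epsilon$. 2. There are $D\subseteq\Delta(\Omega)$ and $F_D\subseteq F\setminus T$ such that (i) $\mu\in D\cup O$, (ii) $F_D\cap\mathcal F(p)\neq\emptyset$ for every $p\in D$, and (iii) $\bigcup_{e\in F_D}\tau(e)\subseteq D\cup O$. 3. There is an infinite sequential persuasion $S$ from $\mu$ with $\mathcal V(S)=\hat v(\mu)$. -/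

import Mathlib

open Filter Topology MeasureTheory

namespace SeqPersuasion

noncomputable section

/-- Beliefs: probability distributions on the finite set `Ω` of world states.  The topology is the
one of `Ω → ℝ`, which is the topology of the total variation distance. -/
abbrev Belief (Ω : Type*) [Fintype Ω] : Type _ := stdSimplex ℝ Ω

/-- An experiment: a probability distribution with finite support on the set of beliefs.
The type of all experiments is the set `F₀`; `e.weight p` is the probability `e(p)`. -/
@[ext]
structure Experiment (Ω : Type*) [Fintype Ω] where
  weight : Belief Ω →₀ ℝ
  weight_nonneg : ∀ p, 0 ≤ weight p
  sum_weight : ∑ p ∈ weight.support, weight p = 1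

namespace Experiment

variable {Ω : Type*} [Fintype Ω]

/-- The support `τ(e)`. -/
def supp (e : Experiment Ω) : Finset (Belief Ω) := e.weight.support

/-- The expectation `∑ λ_j g(p_j)` of a real function of the belief. -/
def expect (e : Experiment Ω) (g : Belief Ω → ℝ) : ℝ := ∑ p ∈ e.supp, e.weight p * g p

/-- The mean `σ(e) = ∑ λ_j p_j`, a belief. -/
def mean (e : Experiment Ω) : Belief Ω :=
  ⟨∑ p ∈ e.supp, e.weight p • (p : Ω → ℝ),
    (convex_stdSimplex ℝ Ω).sum_mem (fun p _ => e.weight_nonneg p) e.sum_weight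
      (fun p _ => p.2)⟩

/-- The trivial experiment `(1, p)`. -/
def trivial (p : Belief Ω) : Experiment Ω where
  weight := Finsupp.single p 1
  weight_nonneg q := by
    classical
    rw [Finsupp.single_apply]
    split_ifs <;> norm_num
  sum_weight := by
    simp [Finsupp.support_single]

/-- The experiment as a Borel probability measure on the space of beliefs. -/
def toProbabilityMeasure (e : Experiment Ω) : ProbabilityMeasure (Belief Ω) :=
  ⟨∑ p ∈ e.supp, ENNReal.ofReal (e.weight p) • Measure.dirac p, ⟨by
    simp only [Measure.coe_finsetSum, Finset.sum_apply, Measure.smul_apply, measure_univ,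
      smul_eq_mul, mul_one]
    rw [← ENNReal.ofReal_sum_of_nonneg (fun p _ => e.weight_nonneg p), supp, e.sum_weight,
      ENNReal.ofReal_one]⟩⟩

end Experiment

variable {Ω : Type*} [Fintype Ω]

/-- The set `T` of trivial experiments. -/
def trivialExperiments (Ω : Type*) [Fintype Ω] : Set (Experiment Ω) :=
  Set.range Experiment.trivial

/-- `𝓕(p)`: the experiments in `F` that spread `p`. -/
def feasibleAt (F : Set (Experiment Ω)) (p : Belief Ω) : Set (Experiment Ω) :=
  {e | e ∈ F ∧ e.mean = p}

/-- The entropy `H(p) = - ∑ p(ω) log p(ω)`. -/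
def entropy (p : Belief Ω) : ℝ := ∑ ω, Real.negMulLog ((p : Ω → ℝ) ω)

/-- The support sizes of the elements of `F` are bounded, and `F` contains the limit of every
sequence in `F` that converges weakly to a Borel probability measure on the space of beliefs. -/
def IsClosedBounded (F : Set (Experiment Ω)) : Prop :=
  (∃ h : ℕ, ∀ e ∈ F, e.supp.card ≤ h) ∧
  ∀ (e : ℕ → Experiment Ω) (ν : ProbabilityMeasure (Belief Ω)), (∀ i, e i ∈ F) →
    Tendsto (fun i => (e i).toProbabilityMeasure) atTop (𝓝 ν) →
    ∃ e' ∈ F, e'.toProbabilityMeasure = ν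

/-- Every nontrivial experiment in `F` lowers the expected entropy by at least some fixed
`δ > 0`. -/
def HasEntropyGap (F : Set (Experiment Ω)) : Prop :=
  ∃ δ : ℝ, 0 < δ ∧ ∀ e ∈ F \ trivialExperiments Ω, e.expect entropy ≤ entropy e.mean - δ

/-- Histories `(p₀, e₁, p₁, …, eₙ, pₙ)`. -/
inductive History (Ω : Type*) [Fintype Ω] : Type _
  | start (p : Belief Ω) : History Ω
  | step (ξ : History Ω) (e : Experiment Ω) (p : Belief Ω) : History Ω

namespace History

/-- The last belief of a history. -/
def last : History Ω → Belief Ω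
  | start p => p
  | step _ _ p => p

/-- `Pr[ξ] = ∏ e_j(p_j)`. -/
def prob : History Ω → ℝ
  | start _ => 1
  | step ξ e p => ξ.prob * e.weight p

/-- `ξ ⊕ ((1, p), p)` with `p = last ξ`. -/
def stay (ξ : History Ω) : History Ω := step ξ (Experiment.trivial ξ.last) ξ.last

end History

/-- A choice rule, which assigns to each history the next experiment.  Histories of different
lengths are different, so a single function carries all of `φ₁, φ₂, …`; only its values on the
reachable histories matter. -/
abbrev Plan (Ω : Type*) [Fintype Ω] : Type _ := History Ω → Experiment Ω

namespace Plan

open Classical in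
/-- The set `Ξₙ` of the `n`-step histories that are reached from the prior `μ`. -/
def histories (φ : Plan Ω) (μ : Belief Ω) : ℕ → Finset (History Ω)
  | 0 => {History.start μ}
  | n + 1 => (histories φ μ n).biUnion fun ξ =>
      (φ ξ).supp.image fun p => History.step ξ (φ ξ) p

open Classical in
/-- `Pr[bₙ ∈ O]`, where `bₙ` is the random belief after `n` steps. -/
def probBelief (φ : Plan Ω) (μ : Belief Ω) (n : ℕ) (O : Set (Belief Ω)) : ℝ :=
  ∑ ξ ∈ φ.histories μ n, if ξ.last ∈ O then ξ.prob else 0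

/-- The infinite sequential persuasion `φ` terminates after the history `ξ`: it chooses the trivial
experiment at `ξ` and forever afterwards. -/
def TerminatesAfter (φ : Plan Ω) (ξ : History Ω) : Prop :=
  ∀ l : ℕ, φ (History.stay^[l] ξ) = Experiment.trivial ξ.last

open Classical in
/-- The expected utility `𝒱(S)` of an infinite sequential persuasion. -/
def value (φ : Plan Ω) (μ : Belief Ω) (v : Belief Ω → ℝ) : ℝ :=
  ⨆ n : ℕ, ∑ ξ ∈ φ.histories μ n, if φ.TerminatesAfter ξ then ξ.prob * v ξ.last else 0

end Plan

/-- The `n`-step sequential persuasions from `μ` with experiments in `F`. -/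
def finitePersuasions (F : Set (Experiment Ω)) (μ : Belief Ω) (n : ℕ) : Set (Plan Ω) :=
  {φ | ∀ i < n, ∀ ξ ∈ φ.histories μ i, φ ξ ∈ feasibleAt F ξ.last}

/-- The infinite sequential persuasions from `μ` with experiments in `F`. -/
def infinitePersuasions (F : Set (Experiment Ω)) (μ : Belief Ω) : Set (Plan Ω) :=
  {φ | ∀ i, ∀ ξ ∈ φ.histories μ i, φ ξ ∈ feasibleAt F ξ.last}

/-- `O` is implementable for the instance `(μ, F)`. -/
def Implementable (F : Set (Experiment Ω)) (μ : Belief Ω) (O : Set (Belief Ω)) : Prop :=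
  ∀ ε : ℝ, 0 < ε → ∃ n : ℕ, ∃ φ ∈ finitePersuasions F μ n, 1 - ε < φ.probBelief μ n O

/-- The concave closure `v̂(p)`: the optimal value over all experiments that spread `p`.  The
supremum is a maximum when `v` is upper semicontinuous. -/
def concaveClosure (v : Belief Ω → ℝ) (p : Belief Ω) : ℝ :=
  sSup {x | ∃ e : Experiment Ω, e.mean = p ∧ x = e.expect v}

/-- The convex hull of a set of beliefs, as a set of beliefs. -/
def conv (O : Set (Belief Ω)) : Set (Belief Ω) :=
  {p | (p : Ω → ℝ) ∈ convexHull ℝ ((↑) '' O : Set (Ω → ℝ))}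

/-- `O` is an optimal support set of unconstrained Bayesian persuasion for `(v, μ)`: its convex hull
contains `μ`, and an experiment that spreads a point of this hull is optimal if and only if its
support lies in `O`. -/
def IsOptimalSupport (v : Belief Ω → ℝ) (μ : Belief Ω) (O : Set (Belief Ω)) : Prop :=
  μ ∈ conv O ∧ ∀ p ∈ conv O, ∀ e : Experiment Ω, e.mean = p →
    (e.expect v = concaveClosure v p ↔ (e.supp : Set (Belief Ω)) ⊆ O)

end

end SeqPersuasion

open SeqPersuasion

namespace SeqPersuasion

noncomputable section

/-! ### Expectations, means, and experiments built from weighted families. -/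

namespace Experiment

variable {Ω : Type*} [Fintype Ω]

/-! Entropy is a budget: every nontrivial experiment lowers expected entropy by at least δ, so a
persuasion can make only boundedly many nontrivial steps on average. The three statements are proved
in a cycle.

(1 ⇒ 2) Let W be the supremum over n of `reach F O n`. The budget makes this convergence uniform at
rate O(1/n) (`reach_le_add`), so W inherits upper semicontinuity from the finite horizons. This
needs O closed, which follows because v is linear on O (`IsOptimalSupport.exists_linear`,
`IsOptimalSupport.isClosed`). Take D to be the set W = 1 outside O. At a point of D, nontrivial
experiments whose expected W tends to 1 subconverge in F; the entropy gap keeps the limit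
nontrivial, and semicontinuity forces W = 1 on its whole support.

(2 ⇒ 3) Apply the family until O is hit, then stop. The budget bounds the probability of missing O
for n steps by O(1/n). If l is the linear function equal to v on O, then the concave closure at μ is
l(μ), the expectation of l after any number of steps, so the loss of value tends to 0.

(3 ⇒ 1) The budget forces termination with probability tending to 1 (`Plan.exists_terminated_prob`),
and a plan of maximal value terminates only in O: completing the stopped mass optimally gives an
optimal experiment at μ with the stopping belief in its support.

An optimal support set is obtained as the union of the supports of all optimal experiments at μ; an
exchange argument extends the defining equivalence from μ to the convex hull. -/

lemma expect_eq_linearCombination (e : Experiment Ω) (g : Belief Ω → ℝ) :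
    e.expect g = Finsupp.linearCombination ℝ g e.weight := by
  simp [expect, supp, Finsupp.linearCombination_apply, Finsupp.sum]

/-- The experiment with outcomes `x i`, not necessarily distinct, of probabilities `w i`. -/
def ofSum {ι : Type*} [Fintype ι] (w : ι → ℝ) (x : ι → Belief Ω) (hw : ∀ i, 0 ≤ w i)
    (h1 : ∑ i, w i = 1) : Experiment Ω where
  weight := ∑ i, Finsupp.single (x i) (w i)
  weight_nonneg p := by
    classical
    rw [Finsupp.finsetSum_apply]
    refine Finset.sum_nonneg fun i _ => ?_
    rw [Finsupp.single_apply]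
    split_ifs
    · exact hw i
    · exact le_rfl
  sum_weight := by
    have h := map_sum (Finsupp.linearCombination ℝ (fun _ : Belief Ω => (1 : ℝ)))
      (fun i => Finsupp.single (x i) (w i)) Finset.univ
    simp only [Finsupp.linearCombination_single, smul_eq_mul, mul_one, h1] at h
    simpa only [Finsupp.linearCombination_apply, Finsupp.sum, smul_eq_mul, mul_one] using h

section ofSum

variable {ι : Type*} [Fintype ι] {w : ι → ℝ} {x : ι → Belief Ω} {hw : ∀ i, 0 ≤ w i}
  {h1 : ∑ i, w i = 1}

lemma expect_ofSum (g : Belief Ω → ℝ) : (ofSum w x hw h1).expect g = ∑ i, w i * g (x i) := by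
  rw [expect_eq_linearCombination, ofSum, map_sum]
  simp

lemma exists_of_mem_supp_ofSum {p : Belief Ω} (hp : p ∈ (ofSum w x hw h1).supp) :
    ∃ i, w i ≠ 0 ∧ x i = p := by
  classical
  rw [supp, Finsupp.mem_support_iff, ofSum, Finsupp.finsetSum_apply] at hp
  obtain ⟨i, -, hi⟩ := Finset.exists_ne_zero_of_sum_ne_zero hp
  rw [Finsupp.single_apply] at hi
  split_ifs at hi with h
  · exact ⟨i, hi, h⟩
  · exact absurd rfl hi

lemma mem_supp_ofSum {i : ι} (hi : w i ≠ 0) : x i ∈ (ofSum w x hw h1).supp := by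
  classical
  rw [supp, Finsupp.mem_support_iff, ofSum, Finsupp.finsetSum_apply]
  refine ne_of_gt (Finset.sum_pos' (fun j _ => ?_) ⟨i, Finset.mem_univ i, ?_⟩)
  · rw [Finsupp.single_apply]
    split_ifs
    · exact hw j
    · exact le_rfl
  · simpa using lt_of_le_of_ne (hw i) hi.symm

end ofSum

lemma weight_pos {e : Experiment Ω} {p : Belief Ω} (hp : p ∈ e.supp) : 0 < e.weight p :=
  lt_of_le_of_ne (e.weight_nonneg p) (Finsupp.mem_support_iff.1 hp).symm

lemma expect_mono {e : Experiment Ω} {f g : Belief Ω → ℝ} (h : ∀ p ∈ e.supp, f p ≤ g p) :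
    e.expect f ≤ e.expect g :=
  Finset.sum_le_sum fun p hp => mul_le_mul_of_nonneg_left (h p hp) (e.weight_nonneg p)

lemma expect_congr {e : Experiment Ω} {f g : Belief Ω → ℝ} (h : ∀ p ∈ e.supp, f p = g p) :
    e.expect f = e.expect g :=
  Finset.sum_congr rfl fun p hp => by rw [h p hp]

lemma expect_const (e : Experiment Ω) (c : ℝ) : e.expect (fun _ => c) = c := by
  rw [expect, ← Finset.sum_mul, supp, e.sum_weight, one_mul]

lemma expect_add (e : Experiment Ω) (f g : Belief Ω → ℝ) :
    e.expect (fun p => f p + g p) = e.expect f + e.expect g := by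
  simp only [expect, mul_add, Finset.sum_add_distrib]

lemma expect_mul_const (e : Experiment Ω) (f : Belief Ω → ℝ) (c : ℝ) :
    e.expect (fun p => f p * c) = e.expect f * c := by
  simp only [expect, ← mul_assoc, ← Finset.sum_mul]

lemma expect_neg (e : Experiment Ω) (f : Belief Ω → ℝ) :
    e.expect (fun p => - f p) = - e.expect f := by
  simp only [expect, mul_neg, Finset.sum_neg_distrib]

lemma expect_nonneg {e : Experiment Ω} {f : Belief Ω → ℝ} (h : ∀ p ∈ e.supp, 0 ≤ f p) :
    0 ≤ e.expect f :=
  Finset.sum_nonneg fun p hp => mul_nonneg (e.weight_nonneg p) (h p hp)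

/-- A function that is at most `1` and has expectation at least `1` is `1` on the support. -/
lemma eq_one_of_one_le_expect {e : Experiment Ω} {f : Belief Ω → ℝ} (hf : ∀ p, f p ≤ 1)
    (h : 1 ≤ e.expect f) {p : Belief Ω} (hp : p ∈ e.supp) : f p = 1 := by
  by_contra hne
  have hlt : e.expect f < e.expect (fun _ => 1) :=
    Finset.sum_lt_sum (fun q _ => mul_le_mul_of_nonneg_left (hf q) (e.weight_nonneg q))
      ⟨p, hp, mul_lt_mul_of_pos_left (lt_of_le_of_ne (hf p) hne) (weight_pos hp)⟩
  rw [expect_const] at hlt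
  linarith

lemma mean_apply (e : Experiment Ω) (ω : Ω) :
    (e.mean : Ω → ℝ) ω = e.expect (fun p => (p : Ω → ℝ) ω) := by
  change (∑ p ∈ e.supp, e.weight p • (p : Ω → ℝ)) ω = _
  simp [expect, Finset.sum_apply]

lemma mean_eq_iff {e : Experiment Ω} {p : Belief Ω} :
    e.mean = p ↔ ∀ ω, e.expect (fun q => (q : Ω → ℝ) ω) = (p : Ω → ℝ) ω := by
  rw [DFunLike.ext_iff]
  simp only [mean_apply]

lemma expect_linear (e : Experiment Ω) (l : (Ω → ℝ) →ₗ[ℝ] ℝ) :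
    e.expect (fun p => l p) = l e.mean := by
  change _ = l (∑ p ∈ e.supp, e.weight p • (p : Ω → ℝ))
  simp [expect, map_sum]

lemma supp_nonempty (e : Experiment Ω) : e.supp.Nonempty := by
  by_contra h
  have := e.sum_weight
  rw [Finset.not_nonempty_iff_eq_empty, supp] at h
  rw [h] at this
  simp at this

@[simp] lemma supp_trivial (p : Belief Ω) : (trivial p).supp = {p} := by
  rw [supp, trivial, Finsupp.support_single _ one_ne_zero]

@[simp] lemma weight_trivial (p : Belief Ω) : (trivial p).weight p = 1 := by
  simp [trivial]

@[simp] lemma expect_trivial (p : Belief Ω) (f : Belief Ω → ℝ) : (trivial p).expect f = f p := by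
  simp [expect]

@[simp] lemma mean_trivial (p : Belief Ω) : (trivial p).mean = p :=
  mean_eq_iff.2 fun _ => expect_trivial p _

lemma integral_toProbabilityMeasure (e : Experiment Ω) (f : Belief Ω → ℝ) :
    ∫ p, f p ∂(e.toProbabilityMeasure : Measure (Belief Ω)) = e.expect f := by
  change ∫ p, f p ∂(∑ p ∈ e.supp, ENNReal.ofReal (e.weight p) • Measure.dirac p) = _
  rw [integral_finsetSum_measure]
  · refine Finset.sum_congr rfl fun p _ => ?_
    rw [integral_smul_measure, integral_dirac, ENNReal.toReal_ofReal (e.weight_nonneg p),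
      smul_eq_mul]
  · intro p _
    exact (integrable_dirac (by simp)).smul_measure ENNReal.ofReal_ne_top

end Experiment

variable {Ω : Type*} [Fintype Ω]

lemma entropy_nonneg (p : Belief Ω) : 0 ≤ entropy p :=
  Finset.sum_nonneg fun ω _ => Real.negMulLog_nonneg (p.2.1 ω)
    ((Finset.single_le_sum (fun i _ => p.2.1 i) (Finset.mem_univ ω)).trans_eq p.2.2)

lemma continuous_belief_apply (ω : Ω) : Continuous fun p : Belief Ω => (p : Ω → ℝ) ω :=
  (continuous_apply ω).comp continuous_subtype_val

lemma continuous_entropy : Continuous (entropy : Belief Ω → ℝ) :=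
  continuous_finsetSum _ fun ω _ => Real.continuous_negMulLog.comp (continuous_belief_apply ω)

/-! ### Compactness of experiments of bounded support size. -/

/-- Experiments with at most `h` outcomes, presented by weights and outcomes. -/
abbrev Presentation (Ω : Type*) [Fintype Ω] (h : ℕ) : Type _ :=
  stdSimplex ℝ (Fin h) × (Fin h → Belief Ω)

namespace Presentation

variable {h : ℕ}

/-- The experiment that is presented. -/
def toExperiment (g : Presentation Ω h) : Experiment Ω :=
  Experiment.ofSum (fun j => g.1 j) g.2 g.1.2.1 g.1.2.2

lemma expect_toExperiment (g : Presentation Ω h) (f : Belief Ω → ℝ) :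
    g.toExperiment.expect f = ∑ j, g.1 j * f (g.2 j) :=
  Experiment.expect_ofSum f

/-- Near a given outcome f stays below a constant c slightly above its value there. Since weights
are nonnegative, weight times f is at most weight times c, which is continuous in the weight. -/
lemma upperSemicontinuous_expect {f : Belief Ω → ℝ} (hf : UpperSemicontinuous f) :
    UpperSemicontinuous fun g : Presentation Ω h => g.toExperiment.expect f := by
  simp only [expect_toExperiment]
  refine upperSemicontinuous_sum fun j _ => ?_
  intro g y hy
  have hcont : ContinuousAt (fun c : ℝ => g.1 j * c) (f (g.2 j)) := by fun_prop
  have h1 : ∀ᶠ c in 𝓝[>] (f (g.2 j)), g.1 j * c < y :=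
    (hcont.eventually (gt_mem_nhds hy)).filter_mono nhdsWithin_le_nhds
  obtain ⟨c, hc, hfc⟩ := (h1.and self_mem_nhdsWithin).exists
  have hw : Continuous fun g : Presentation Ω h => g.1 j :=
    (continuous_apply j).comp (continuous_subtype_val.comp continuous_fst)
  have hx : Continuous fun g : Presentation Ω h => g.2 j :=
    (continuous_apply j).comp continuous_snd
  filter_upwards [hx.continuousAt.eventually (hf (g.2 j) c hfc),
    (hw.mul_const c).continuousAt.eventually (gt_mem_nhds hc)] with g' h2 h3
  exact (mul_le_mul_of_nonneg_left h2.le (g'.1.2.1 j)).trans_lt h3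

lemma continuous_expect {f : Belief Ω → ℝ} (hf : Continuous f) :
    Continuous fun g : Presentation Ω h => g.toExperiment.expect f := by
  rw [continuous_iff_lower_upperSemicontinuous]
  refine ⟨?_, upperSemicontinuous_expect hf.upperSemicontinuous⟩
  intro g y hy
  have := upperSemicontinuous_expect (h := h) (f := fun p => -f p) hf.neg.upperSemicontinuous g (-y)
    (by simpa [Experiment.expect_neg] using hy)
  filter_upwards [this] with g' hg'
  simpa [Experiment.expect_neg] using hg'

lemma isClosed_mean_eq (p : Belief Ω) :
    IsClosed {g : Presentation Ω h | g.toExperiment.mean = p} := by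
  simp only [Experiment.mean_eq_iff, Set.ofPred_forall]
  exact isClosed_iInter fun ω =>
    isClosed_eq (continuous_expect (continuous_belief_apply ω)) continuous_const

lemma exists_of_fintype {ι : Type*} [Fintype ι] (hι : Fintype.card ι ≤ h) {w : ι → ℝ}
    (x : ι → Belief Ω) (hw : ∀ i, 0 ≤ w i) (h1 : ∑ i, w i = 1) :
    ∃ g : Presentation Ω h, ∀ f, g.toExperiment.expect f = ∑ i, w i * f (x i) := by
  classical
  obtain ⟨k⟩ := Function.Embedding.nonempty_of_card_le (α := ι) (β := Fin h) (by simpa using hι)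
  have hne : Nonempty ι := by
    by_contra hne
    rw [not_nonempty_iff] at hne
    simp at h1
  obtain ⟨i₀⟩ := hne
  -- Unused slots get weight 0 and the arbitrary outcome `x i₀`, so they contribute nothing.
  have hsum : ∀ f : Belief Ω → ℝ, ∑ i, w i * f (x i) =
      ∑ j, Function.extend k w 0 j * f (Function.extend k x (fun _ => x i₀) j) := fun f =>
    Fintype.sum_of_injective k k.injective _ _
      (fun j hj => by rw [Function.extend_apply' _ _ _ (by simpa using hj)]; simp)
      (fun i => by rw [k.injective.extend_apply, k.injective.extend_apply])
  refine ⟨⟨⟨Function.extend k w 0, fun j => ?_, ?_⟩, Function.extend k x fun _ => x i₀⟩,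
    fun f => ?_⟩
  · by_cases hj : ∃ i, k i = j
    · obtain ⟨i, rfl⟩ := hj
      rw [k.injective.extend_apply]
      exact hw i
    · rw [Function.extend_apply' _ _ _ hj]
      rfl
  · simpa [h1] using (hsum fun _ => 1).symm
  · rw [expect_toExperiment, hsum]
    rfl

lemma exists_of_experiment {e : Experiment Ω} (he : e.supp.card ≤ h) :
    ∃ g : Presentation Ω h, ∀ f, g.toExperiment.expect f = e.expect f := by
  obtain ⟨g, hg⟩ := exists_of_fintype (h := h) (ι := e.supp) (by simpa using he)
    (w := fun p => e.weight p) (fun p => (p : Belief Ω)) (fun p => e.weight_nonneg p)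
    (by rw [← e.sum_weight]; exact Finset.sum_coe_sort e.supp (fun p => e.weight p))
  refine ⟨g, fun f => ?_⟩
  rw [hg, Experiment.expect]
  exact Finset.sum_coe_sort e.supp fun p => e.weight p * f p

end Presentation

/-- Sequential compactness of `F`: a subsequence converges to an element of `F`, and expectations of
upper semicontinuous functions are upper semicontinuous along it. -/
theorem IsClosedBounded.exists_subseq {F : Set (Experiment Ω)} (hF : IsClosedBounded F)
    {e : ℕ → Experiment Ω} (he : ∀ k, e k ∈ F) :
    ∃ e' ∈ F, ∃ φ : ℕ → ℕ, StrictMono φ ∧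
      (∀ f, UpperSemicontinuous f → ∀ c, e'.expect f < c →
        ∀ᶠ k in atTop, (e (φ k)).expect f < c) ∧
      ∀ f, Continuous f → Tendsto (fun k => (e (φ k)).expect f) atTop (𝓝 (e'.expect f)) := by
  obtain ⟨⟨h, hh⟩, hcl⟩ := hF
  choose g hg using fun k => Presentation.exists_of_experiment (hh (e k) (he k))
  -- In the limit outcomes may merge and weights may vanish; presentations allow both, so their
  -- space is compact.
  obtain ⟨a, φ, hφ, hlim⟩ := CompactSpace.tendsto_subseq g
  have hcont : ∀ f : Belief Ω → ℝ, Continuous f →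
      Tendsto (fun k => (e (φ k)).expect f) atTop (𝓝 (a.toExperiment.expect f)) := by
    intro f hf
    simp only [← hg]
    exact ((Presentation.continuous_expect hf).tendsto a).comp hlim
  obtain ⟨e', he'F, he'⟩ := hcl (fun k => e (φ k)) a.toExperiment.toProbabilityMeasure
    (fun k => he _) (by
      rw [ProbabilityMeasure.tendsto_iff_forall_integral_tendsto]
      intro f
      simp only [Experiment.integral_toProbabilityMeasure]
      exact hcont f f.continuous)
  have hexp : ∀ f, e'.expect f = a.toExperiment.expect f := fun f => by
    rw [← Experiment.integral_toProbabilityMeasure, he', Experiment.integral_toProbabilityMeasure]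
  refine ⟨e', he'F, φ, hφ, fun f hf c hc => ?_, fun f hf => ?_⟩
  · rw [hexp] at hc
    simp only [← hg]
    exact hlim.eventually (Presentation.upperSemicontinuous_expect hf a c hc)
  · rw [hexp]
    exact hcont f hf

/-! ### Attainment of the concave closure. -/

lemma exists_bound_of_upperSemicontinuous {v : Belief Ω → ℝ} (hv : UpperSemicontinuous v) :
    ∃ M, ∀ p, v p ≤ M := by
  obtain ⟨M, hM⟩ := (hv.upperSemicontinuousOn Set.univ).bddAbove_of_isCompact isCompact_univ
  exact ⟨M, fun p => hM ⟨p, trivial, rfl⟩⟩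

lemma expect_le_concaveClosure {v : Belief Ω → ℝ} (hv : UpperSemicontinuous v)
    (e : Experiment Ω) : e.expect v ≤ concaveClosure v e.mean := by
  obtain ⟨M, hM⟩ := exists_bound_of_upperSemicontinuous hv
  refine le_csSup ⟨M, ?_⟩ ⟨e, rfl, rfl⟩
  rintro _ ⟨e', -, rfl⟩
  exact (Experiment.expect_mono fun p _ => hM p).trans_eq (e'.expect_const M)

/-- Carathéodory's theorem for experiments. -/
lemma exists_presentation_of_experiment (v : Belief Ω → ℝ) (e : Experiment Ω) :
    ∃ g : Presentation Ω (Fintype.card Ω + 2),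
      g.toExperiment.mean = e.mean ∧ g.toExperiment.expect v = e.expect v := by
  -- Carathéodory is applied to the graph of v, in dimension `card Ω + 1`, so that mean and value
  -- are preserved together. Only the uniformity of the bound `card Ω + 2` matters.
  let G : Belief Ω → (Ω → ℝ) × ℝ := fun p => (p, v p)
  have hmem : ((e.mean : Ω → ℝ), e.expect v) ∈ convexHull ℝ (Set.range G) := by
    have h : ∑ p ∈ e.supp, e.weight p • G p ∈ convexHull ℝ (Set.range G) :=
      (convex_convexHull ℝ _).sum_mem (fun p _ => e.weight_nonneg p) e.sum_weight
        fun p _ => subset_convexHull ℝ _ ⟨p, rfl⟩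
    convert h using 1
    refine Prod.ext ?_ ?_
    · rw [Prod.fst_sum]
      rfl
    · rw [Prod.snd_sum]
      rfl
  obtain ⟨ι, _, z, w, hz, hai, hw, h1, hsum⟩ := eq_pos_convex_span_of_mem_convexHull hmem
  choose x hx using fun i => hz ⟨i, rfl⟩
  have hcard : Fintype.card ι ≤ Fintype.card Ω + 2 := by
    refine hai.card_le_finrank_succ.trans ?_
    have h := Submodule.finrank_le (vectorSpan ℝ (Set.range z))
    rw [Module.finrank_prod, Module.finrank_fintype_fun_eq_card, Module.finrank_self] at h
    omega
  obtain ⟨g, hg⟩ := Presentation.exists_of_fintype hcard x (fun i => (hw i).le) h1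
  refine ⟨g, Experiment.mean_eq_iff.2 fun ω => ?_, ?_⟩
  · have := congrArg (fun y : (Ω → ℝ) × ℝ => y.1 ω) hsum
    rw [hg]
    simpa [← hx, G, Prod.fst_sum] using this
  · have := congrArg Prod.snd hsum
    rw [hg]
    simpa [← hx, G, Prod.snd_sum] using this

/-- The supremum that defines the concave closure is attained. -/
theorem exists_expect_eq_concaveClosure {v : Belief Ω → ℝ} (hv : UpperSemicontinuous v)
    (p : Belief Ω) : ∃ e : Experiment Ω, e.mean = p ∧ e.expect v = concaveClosure v p := by
  obtain ⟨g₀, hg₀, -⟩ := exists_presentation_of_experiment v (Experiment.trivial p)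
  rw [Experiment.mean_trivial] at hg₀
  obtain ⟨g, hg, hmax⟩ := ((Presentation.upperSemicontinuous_expect (h := Fintype.card Ω + 2)
    hv).upperSemicontinuousOn _).exists_isMaxOn ⟨g₀, hg₀⟩ (Presentation.isClosed_mean_eq p).isCompact
  refine ⟨g.toExperiment, hg, le_antisymm ?_ (csSup_le ⟨_, _, hg₀, rfl⟩ ?_)⟩
  · have := expect_le_concaveClosure hv g.toExperiment
    rwa [show g.toExperiment.mean = p from hg] at this
  · rintro _ ⟨e, he, rfl⟩
    obtain ⟨g', hg', hval⟩ := exists_presentation_of_experiment v e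
    rw [← hval]
    exact hmax (hg'.trans he)

/-! ### Exchanging, removing and adding parts of experiments. -/

namespace Experiment

/-- In the mixture of the experiments `E q` over `f`, the part `c • f` is replaced by `c • e`. -/
lemma exists_replace (e f : Experiment Ω) (E : Belief Ω → Experiment Ω) {c : ℝ} (hc : 0 < c)
    (hE : ∀ q ∈ f.supp, c ≤ (E q).weight q) :
    ∃ e' : Experiment Ω, e.supp ⊆ e'.supp ∧ ∀ g, e'.expect g =
      c * e.expect g + (f.expect (fun q => (E q).expect g) - c * f.expect g) := by
  classical
  -- The left summand carries c • e. The right one carries the mixture with mass c * f(q) removed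
  -- from the outcome q of `E q`; `hE` keeps it nonnegative.
  let w : e.supp ⊕ (Σ q : f.supp, (E q).supp) → ℝ := Sum.elim (fun p => c * e.weight p)
    fun r => f.weight r.1 * ((E r.1).weight r.2 - if (r.2 : Belief Ω) = r.1 then c else 0)
  let x : e.supp ⊕ (Σ q : f.supp, (E q).supp) → Belief Ω := Sum.elim (fun p => p) fun r => r.2
  have hw : ∀ i, 0 ≤ w i := by
    rintro (p | ⟨q, r⟩)
    · exact mul_nonneg hc.le (e.weight_nonneg _)
    · refine mul_nonneg (f.weight_nonneg _) ?_
      dsimp only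
      split_ifs with h
      · rw [h]
        exact sub_nonneg.2 (hE q q.2)
      · rw [sub_zero]
        exact (E q).weight_nonneg _
  have hsum : ∀ g : Belief Ω → ℝ, ∑ i, w i * g (x i) =
      c * e.expect g + (f.expect (fun q => (E q).expect g) - c * f.expect g) := by
    intro g
    have hq : ∀ q ∈ f.supp, ∑ r : (E q).supp, f.weight q *
        ((E q).weight r - if (r : Belief Ω) = q then c else 0) * g r =
        f.weight q * (E q).expect g - c * (f.weight q * g q) := by
      intro q hq
      have hmem : q ∈ (E q).supp :=
        Finsupp.mem_support_iff.2 (hc.trans_le (hE q hq)).ne'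
      rw [Finset.sum_coe_sort (E q).supp fun r => f.weight q *
        ((E q).weight r - if r = q then c else 0) * g r]
      simp only [mul_sub, sub_mul, Finset.sum_sub_distrib, mul_ite, ite_mul, mul_zero, zero_mul,
        Finset.sum_ite_eq' _ q, hmem, if_true, expect, Finset.mul_sum]
      congr 1
      · exact Finset.sum_congr rfl fun _ _ => by ring
      · ring
    rw [Fintype.sum_sum_type, Fintype.sum_sigma]
    congr 1
    · change ∑ p : e.supp, c * e.weight p * g p = _
      rw [Finset.sum_coe_sort e.supp fun p => c * e.weight p * g p, expect, Finset.mul_sum]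
      exact Finset.sum_congr rfl fun _ _ => by ring
    · change ∑ q : f.supp, ∑ r : (E q).supp, f.weight q *
        ((E q).weight r - if (r : Belief Ω) = q then c else 0) * g r = _
      rw [Finset.sum_congr rfl fun (q : f.supp) _ => hq q q.2,
        Finset.sum_coe_sort f.supp fun q => f.weight q * (E q).expect g - c * (f.weight q * g q),
        Finset.sum_sub_distrib, ← Finset.mul_sum]
      rfl
  have h1 : ∑ i, w i = 1 := by
    have := hsum fun _ => 1
    simp only [mul_one, expect_const] at this
    linarith
  refine ⟨ofSum w x hw h1, fun p hp => ?_, fun g => ?_⟩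
  · exact mem_supp_ofSum (x := x) (i := Sum.inl ⟨p, hp⟩) (mul_pos hc (weight_pos hp)).ne'
  · rw [expect_ofSum, hsum]

/-- The part of `e` that remains when probability `a` is removed from the outcome `p`. -/
lemma exists_remainder (e : Experiment Ω) {p : Belief Ω} {a : ℝ} (ha0 : 0 < a) (ha1 : a < 1)
    (ha : a ≤ e.weight p) :
    ∃ g : Experiment Ω, ∀ f, e.expect f = a * f p + (1 - a) * g.expect f := by
  classical
  have hmem : p ∈ e.supp := Finsupp.mem_support_iff.2 (ha0.trans_le ha).ne'
  have h1a : 0 < 1 - a := sub_pos.2 ha1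
  let w : e.supp → ℝ := fun q => (e.weight q - if (q : Belief Ω) = p then a else 0) / (1 - a)
  have hw : ∀ q, 0 ≤ w q := by
    intro q
    refine div_nonneg ?_ h1a.le
    split_ifs with h
    · rw [h]
      exact sub_nonneg.2 ha
    · rw [sub_zero]
      exact e.weight_nonneg _
  have hsum : ∀ f : Belief Ω → ℝ, e.expect f = a * f p + (1 - a) * ∑ q, w q * f q := by
    intro f
    have : ∑ q, w q * f q = (e.expect f - a * f p) / (1 - a) := by
      change ∑ q : e.supp, (e.weight q - if (q : Belief Ω) = p then a else 0) / (1 - a) * f q = _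
      rw [Finset.sum_coe_sort e.supp fun q =>
        (e.weight q - if q = p then a else 0) / (1 - a) * f q]
      simp only [div_mul_eq_mul_div, ← Finset.sum_div, sub_mul, Finset.sum_sub_distrib, ite_mul,
        zero_mul, Finset.sum_ite_eq' _ p, hmem, if_true, expect]
    rw [this]
    field_simp
    ring
  have h1 : ∑ q, w q = 1 := by
    have := hsum fun _ => 1
    simp only [mul_one, expect_const] at this
    have h : (1 - a) * (∑ q, w q - 1) = 0 := by linarith
    rcases mul_eq_zero.1 h with h | h <;> linarith
  exact ⟨ofSum w (fun q => q) hw h1, fun f => by rw [expect_ofSum, hsum]⟩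

/-- The mixture of the outcome `p`, with probability `a`, and `g`. -/
lemma exists_mix (g : Experiment Ω) (p : Belief Ω) {a : ℝ} (ha0 : 0 < a) (ha1 : a ≤ 1) :
    ∃ e : Experiment Ω, p ∈ e.supp ∧ ∀ f, e.expect f = a * f p + (1 - a) * g.expect f := by
  let w : Option g.supp → ℝ := fun o => o.elim a fun q => (1 - a) * g.weight q
  let x : Option g.supp → Belief Ω := fun o => o.elim p fun q => q
  have hw : ∀ o, 0 ≤ w o := by
    rintro (_ | q)
    · exact ha0.le
    · exact mul_nonneg (sub_nonneg.2 ha1) (g.weight_nonneg _)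
  have hsum : ∀ f : Belief Ω → ℝ, ∑ o, w o * f (x o) = a * f p + (1 - a) * g.expect f := by
    intro f
    rw [Fintype.sum_option]
    congr 1
    change ∑ q : g.supp, (1 - a) * g.weight q * f q = _
    rw [Finset.sum_coe_sort g.supp fun q => (1 - a) * g.weight q * f q, expect, Finset.mul_sum]
    exact Finset.sum_congr rfl fun _ _ => by ring
  have h1 : ∑ o, w o = 1 := by
    have := hsum fun _ => 1
    simp only [mul_one, expect_const] at this
    linarith
  exact ⟨ofSum w x hw h1, mem_supp_ofSum (x := x) (i := none) ha0.ne',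
    fun f => by rw [expect_ofSum, hsum]⟩

end Experiment

/-! ### Optimal support sets: existence, linearity of the utility, closedness. -/

lemma mean_mem_conv {O : Set (Belief Ω)} {e : Experiment Ω} (he : (e.supp : Set (Belief Ω)) ⊆ O) :
    e.mean ∈ conv O :=
  (convex_convexHull ℝ _).sum_mem (fun p _ => e.weight_nonneg p) e.sum_weight
    fun p hp => subset_convexHull ℝ _ ⟨p, he hp, rfl⟩

lemma exists_experiment_of_mem_conv {O : Set (Belief Ω)} {p : Belief Ω} (hp : p ∈ conv O) :
    ∃ e : Experiment Ω, e.mean = p ∧ (e.supp : Set (Belief Ω)) ⊆ O := by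
  obtain ⟨ι, _, w, z, hw, h1, hz, hsum⟩ := mem_convexHull_iff_exists_fintype.1 hp
  choose x hxO hx using hz
  refine ⟨Experiment.ofSum w x hw h1, Experiment.mean_eq_iff.2 fun ω => ?_, fun q hq => ?_⟩
  · have := congrFun hsum ω
    rw [Experiment.expect_ofSum]
    simpa [← hx] using this
  · obtain ⟨i, -, rfl⟩ := Experiment.exists_of_mem_supp_ofSum hq
    exact hxO i

/-- The beliefs that occur in optimal experiments at `μ` form an optimal support set. -/
theorem exists_isOptimalSupport {v : Belief Ω → ℝ} (hv : UpperSemicontinuous v) (μ : Belief Ω) :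
    ∃ O, IsOptimalSupport v μ O := by
  let O : Set (Belief Ω) :=
    {q | ∃ e : Experiment Ω, e.mean = μ ∧ e.expect v = concaveClosure v μ ∧ q ∈ e.supp}
  -- Mix, over f, optimal experiments at μ that contain the outcomes of f, and exchange a part c • f
  -- for c • e. The mean stays μ and the value changes by c times the difference of expectations, so
  -- optimality gives the inequality; under equality the new experiment is optimal and contains the
  -- support of e.
  have key : ∀ e f : Experiment Ω, (f.supp : Set (Belief Ω)) ⊆ O → e.mean = f.mean →
      e.expect v ≤ f.expect v ∧ (e.expect v = f.expect v → (e.supp : Set (Belief Ω)) ⊆ O) := by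
    intro e f hf hmean
    have hex : ∀ q, ∃ e : Experiment Ω, q ∈ f.supp →
        e.mean = μ ∧ e.expect v = concaveClosure v μ ∧ q ∈ e.supp := by
      intro q
      by_cases hq : q ∈ f.supp
      · obtain ⟨e, he⟩ := hf hq
        exact ⟨e, fun _ => he⟩
      · exact ⟨e, fun h => absurd h hq⟩
    choose E hE using hex
    -- The smallest weight of q in `E q` is a constant c that works for all outcomes of f.
    obtain ⟨q₀, hq₀, hmin⟩ :=
      f.supp.exists_min_image (fun q => (E q).weight q) f.supp_nonempty
    have hc := Experiment.weight_pos (hE q₀ hq₀).2.2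
    obtain ⟨e', hsub, he'⟩ := Experiment.exists_replace e f E hc hmin
    set c := (E q₀).weight q₀
    have hmean' : e'.mean = μ := by
      refine Experiment.mean_eq_iff.2 fun ω => ?_
      rw [he', Experiment.mean_eq_iff.1 hmean ω, Experiment.mean_apply,
        Experiment.expect_congr (e := f) (g := fun _ => (μ : Ω → ℝ) ω)
          (fun q hq => Experiment.mean_eq_iff.1 (hE q hq).1 ω), Experiment.expect_const]
      ring
    have hval : e'.expect v = concaveClosure v μ + c * (e.expect v - f.expect v) := by
      rw [he', Experiment.expect_congr (e := f) (g := fun _ => concaveClosure v μ)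
        (fun q hq => (hE q hq).2.1), Experiment.expect_const]
      ring
    refine ⟨?_, fun heq q hq => ⟨e', hmean', by rw [hval, heq, sub_self, mul_zero, add_zero],
      hsub hq⟩⟩
    have hle := expect_le_concaveClosure hv e'
    rw [hmean', hval] at hle
    have : c * (e.expect v - f.expect v) ≤ 0 := by linarith
    have := nonpos_of_mul_nonpos_right this hc
    linarith
  refine ⟨O, ?_, ?_⟩
  · obtain ⟨e, he, hopt⟩ := exists_expect_eq_concaveClosure hv μ
    have := mean_mem_conv (O := O) (e := e) fun q hq => ⟨e, he, hopt, hq⟩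
    rwa [he] at this
  · rintro p hp e rfl
    obtain ⟨f, hfm, hf⟩ := exists_experiment_of_mem_conv hp
    have hopt : ∀ f : Experiment Ω, f.mean = e.mean → (f.supp : Set (Belief Ω)) ⊆ O →
        f.expect v = concaveClosure v e.mean := by
      intro f hfm hf
      obtain ⟨e', he', hval⟩ := exists_expect_eq_concaveClosure hv e.mean
      refine le_antisymm ?_ ?_
      · rw [← hfm]
        exact expect_le_concaveClosure hv f
      · rw [← hval]
        exact (key e' f hf (he'.trans hfm.symm)).1
    exact ⟨fun h => (key e f hf hfm.symm).2 (h.trans (hopt f hfm hf).symm), hopt e rfl⟩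

namespace IsOptimalSupport

variable {v : Belief Ω → ℝ} {μ : Belief Ω} {O : Set (Belief Ω)}

lemma expect_eq_of_supp_subset (hO : IsOptimalSupport v μ O) {e : Experiment Ω}
    (he : (e.supp : Set (Belief Ω)) ⊆ O) : e.expect v = concaveClosure v e.mean :=
  (hO.2 _ (mean_mem_conv he) e rfl).2 he

/-- On an optimal support set the utility function is linear. -/
theorem exists_linear (hO : IsOptimalSupport v μ O) :
    ∃ l : (Ω → ℝ) →ₗ[ℝ] ℝ, ∀ q ∈ O, v q = l q := by
  let s : Set ((Ω → ℝ) × ℝ) := (fun q : Belief Ω => ((q : Ω → ℝ), v q)) '' O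
  -- Otherwise a signed combination of points of O vanishes while the same combination of values of
  -- v is 1. Its normalised positive and negative parts are experiments in O with equal means, hence
  -- both optimal, yet with different values.
  have hnot : ((0, 1) : (Ω → ℝ) × ℝ) ∉ Submodule.span ℝ s := by
    intro hmem
    obtain ⟨n, c, g, hsum⟩ := Submodule.mem_span_set'.1 hmem
    choose x hxO hx using fun i => (g i).2
    have hfst : ∀ ω, ∑ i, c i * (x i : Ω → ℝ) ω = 0 := by
      intro ω
      have := congrArg (fun y : (Ω → ℝ) × ℝ => y.1 ω) hsum
      simpa [← hx, Prod.fst_sum] using this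
    have hsnd : ∑ i, c i * v (x i) = 1 := by
      have := congrArg Prod.snd hsum
      simpa [← hx, Prod.snd_sum] using this
    have hc : ∑ i, c i = 0 := by
      have h : ∑ ω, ∑ i, c i * (x i : Ω → ℝ) ω = 0 := Finset.sum_eq_zero fun ω _ => hfst ω
      rw [Finset.sum_comm] at h
      rw [← h]
      refine Finset.sum_congr rfl fun i _ => ?_
      rw [← Finset.mul_sum, show ∑ ω, (x i : Ω → ℝ) ω = 1 from (x i).2.2, mul_one]
    have hsplit : ∀ f : Fin n → ℝ,
        ∑ i, max (c i) 0 * f i = ∑ i, max (-c i) 0 * f i + ∑ i, c i * f i := by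
      intro f
      rw [← Finset.sum_add_distrib]
      refine Finset.sum_congr rfl fun i _ => ?_
      rcases le_total (c i) 0 with h | h
      · rw [max_eq_right h, max_eq_left (by linarith)]
        ring
      · rw [max_eq_left h, max_eq_right (by linarith)]
        ring
    have hP : ∑ i, max (c i) 0 = ∑ i, max (-c i) 0 := by
      have := hsplit fun _ => 1
      simp only [mul_one, hc, add_zero] at this
      exact this
    have hPpos : 0 < ∑ i, max (c i) 0 := by
      refine lt_of_le_of_ne (Finset.sum_nonneg fun i _ => le_max_right _ _) fun h0 => ?_
      have hall : ∀ i, c i ≤ 0 := fun i => by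
        have := (Finset.sum_eq_zero_iff_of_nonneg fun i _ => le_max_right (c i) 0).1 h0.symm i
          (Finset.mem_univ i)
        exact max_eq_right_iff.1 this
      have hzero := (Finset.sum_eq_zero_iff_of_nonpos fun i _ => hall i).1 hc
      have : ∑ i, c i * v (x i) = 0 :=
        Finset.sum_eq_zero fun i hi => by rw [hzero i hi, zero_mul]
      linarith
    set P := ∑ i, max (c i) 0
    let e₁ := Experiment.ofSum (fun i => max (c i) 0 / P) x
      (fun i => div_nonneg (le_max_right _ _) hPpos.le)
      (by rw [← Finset.sum_div, div_self hPpos.ne'])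
    let e₂ := Experiment.ofSum (fun i => max (-c i) 0 / P) x
      (fun i => div_nonneg (le_max_right _ _) hPpos.le)
      (by rw [← Finset.sum_div, ← hP, div_self hPpos.ne'])
    have hdiff : ∀ f : Belief Ω → ℝ,
        e₁.expect f = e₂.expect f + (∑ i, c i * f (x i)) / P := by
      intro f
      simp only [e₁, e₂, Experiment.expect_ofSum, div_mul_eq_mul_div, ← Finset.sum_div]
      rw [hsplit, add_div]
    have hmean : e₁.mean = e₂.mean := by
      refine Experiment.mean_eq_iff.2 fun ω => ?_
      rw [hdiff, hfst, zero_div, add_zero, Experiment.mean_apply]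
    have h₁ := hO.expect_eq_of_supp_subset (e := e₁) fun q hq => by
      obtain ⟨i, -, rfl⟩ := Experiment.exists_of_mem_supp_ofSum hq
      exact hxO i
    have h₂ := hO.expect_eq_of_supp_subset (e := e₂) fun q hq => by
      obtain ⟨i, -, rfl⟩ := Experiment.exists_of_mem_supp_ofSum hq
      exact hxO i
    rw [hmean, ← h₂, hdiff, hsnd] at h₁
    have : 0 < 1 / P := by positivity
    linarith
  obtain ⟨f, hf0, hf⟩ := Submodule.exists_le_ker_of_notMem hnot
  -- The functional f kills the graph of v over O but not the vertical direction, so f(q, v q) = 0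
  -- can be solved for v q.
  refine ⟨(-(f (0, 1))⁻¹) • f ∘ₗ LinearMap.inl ℝ (Ω → ℝ) ℝ, fun q hq => ?_⟩
  have h0 : f ((q : Ω → ℝ), v q) = 0 := hf (Submodule.subset_span ⟨q, hq, rfl⟩)
  have hdec : ((q : Ω → ℝ), v q) = ((q : Ω → ℝ), (0 : ℝ)) + v q • ((0, 1) : (Ω → ℝ) × ℝ) := by
    simp
  rw [hdec, map_add, map_smul, smul_eq_mul] at h0
  simp only [LinearMap.smul_apply, LinearMap.comp_apply, LinearMap.inl_apply, smul_eq_mul]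
  field_simp
  linarith

/-- Optimal support sets are closed. -/
theorem isClosed (hO : IsOptimalSupport v μ O) (hv : UpperSemicontinuous v) : IsClosed O := by
  obtain ⟨l, hl⟩ := hO.exists_linear
  refine isClosed_of_closure_subset fun q hq => ?_
  have hlcont : Continuous fun p : Belief Ω => l p :=
    l.continuous_of_finiteDimensional.comp continuous_subtype_val
  -- Semicontinuity gives only this inequality at a limit point; it suffices, since q then does at
  -- least as well as the signed combination of points of O that equals q.
  have hvq : l q ≤ v q := by
    by_contra! hlt
    obtain ⟨c, hc1, hc2⟩ := exists_between hlt
    obtain ⟨p, hpO, hp1, hp2⟩ := ((mem_closure_iff_frequently.1 hq).and_eventually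
      ((hv q c hc1).and (hlcont.continuousAt.eventually (lt_mem_nhds hc2)))).exists
    rw [hl p hpO] at hp1
    exact lt_asymm hp1 hp2
  have hspan : (q : Ω → ℝ) ∈ Submodule.span ℝ ((fun p : Belief Ω => (p : Ω → ℝ)) '' O) := by
    have hcont : Continuous fun p : Belief Ω => (p : Ω → ℝ) := continuous_subtype_val
    have hcl := (Submodule.closed_of_finiteDimensional
      (Submodule.span ℝ ((fun p : Belief Ω => (p : Ω → ℝ)) '' O))).preimage hcont
    have hsub : O ⊆ (fun p : Belief Ω => (p : Ω → ℝ)) ⁻¹'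
        (Submodule.span ℝ ((fun p : Belief Ω => (p : Ω → ℝ)) '' O) : Set (Ω → ℝ)) :=
      fun p hp => Submodule.subset_span ⟨p, hp, rfl⟩
    exact closure_minimal hsub hcl hq
  obtain ⟨n, c, g, hsum⟩ := Submodule.mem_span_set'.1 hspan
  choose x hxO hx using fun i => (g i).2
  have hcomb : ∀ ω, ∑ i, c i * (x i : Ω → ℝ) ω = (q : Ω → ℝ) ω := by
    intro ω
    have := congrFun hsum ω
    simpa [← hx] using this
  have hc : ∑ i, c i = 1 := by
    have h : ∑ ω, ∑ i, c i * (x i : Ω → ℝ) ω = 1 :=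
      (Finset.sum_congr rfl fun ω _ => hcomb ω).trans q.2.2
    rw [Finset.sum_comm] at h
    rw [← h]
    refine Finset.sum_congr rfl fun i _ => ?_
    rw [← Finset.mul_sum, show ∑ ω, (x i : Ω → ℝ) ω = 1 from (x i).2.2, mul_one]
  have hn : 0 < (n : ℝ) := by
    rcases Nat.eq_zero_or_pos n with rfl | h
    · simp at hc
    · exact_mod_cast h
  set A := 1 + ∑ i, |c i|
  have hA : 0 < A := by
    have := Finset.sum_nonneg fun i (_ : i ∈ Finset.univ) => abs_nonneg (c i)
    linarith
  have hAc : ∀ i, c i ≤ A := fun i => by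
    have := Finset.single_le_sum (fun i _ => abs_nonneg (c i)) (Finset.mem_univ i)
    have := le_abs_self (c i)
    linarith
  set t := 1 / (n * A)
  have ht : 0 < t := by positivity
  let e₀ := Experiment.ofSum (fun _ : Fin n => 1 / (n : ℝ)) x (fun _ => by positivity)
    (by simp [hn.ne'])
  let w : Option (Fin n) → ℝ := fun o => o.elim t fun i => 1 / n - t * c i
  let y : Option (Fin n) → Belief Ω := fun o => o.elim q x
  have hw : ∀ o, 0 ≤ w o := by
    rintro (_ | i)
    · exact ht.le
    · have : t * c i ≤ t * A := mul_le_mul_of_nonneg_left (hAc i) ht.le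
      have htA : t * A = 1 / n := by
        simp only [t]
        field_simp
      change 0 ≤ 1 / (n : ℝ) - t * c i
      linarith
  have hwsum : ∀ f : Belief Ω → ℝ,
      ∑ o, w o * f (y o) = e₀.expect f + t * (f q - ∑ i, c i * f (x i)) := by
    intro f
    rw [Fintype.sum_option, Experiment.expect_ofSum]
    change t * f q + ∑ i, (1 / (n : ℝ) - t * c i) * f (x i) = _
    simp only [sub_mul, Finset.sum_sub_distrib, mul_assoc, ← Finset.mul_sum]
    ring
  have h1 : ∑ o, w o = 1 := by
    have := hwsum fun _ => 1
    simp only [mul_one, Experiment.expect_const, hc] at this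
    linarith
  let e := Experiment.ofSum w y hw h1
  have hexp : ∀ f, e.expect f = e₀.expect f + t * (f q - ∑ i, c i * f (x i)) := fun f => by
    rw [Experiment.expect_ofSum, hwsum]
  have he₀ : (e₀.supp : Set (Belief Ω)) ⊆ O := fun p hp => by
    obtain ⟨i, -, rfl⟩ := Experiment.exists_of_mem_supp_ofSum hp
    exact hxO i
  have hmean : e.mean = e₀.mean := by
    refine Experiment.mean_eq_iff.2 fun ω => ?_
    rw [hexp, hcomb, Experiment.mean_apply]
    ring
  have hopt : e.expect v = concaveClosure v e₀.mean := by
    refine le_antisymm ?_ ?_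
    · rw [← hmean]
      exact expect_le_concaveClosure hv e
    · rw [← hO.expect_eq_of_supp_subset he₀, hexp]
      have hlq : l q = ∑ i, c i * v (x i) := by
        have := congrArg l hsum
        rw [map_sum] at this
        rw [← this]
        refine Finset.sum_congr rfl fun i _ => ?_
        rw [map_smul, smul_eq_mul, hl _ (hxO i), ← hx]
      have := mul_nonneg ht.le (sub_nonneg.2 (hlq ▸ hvq))
      linarith
  exact (hO.2 _ (mean_mem_conv he₀) e hmean).1 hopt
    (Experiment.mem_supp_ofSum (x := y) (i := none) ht.ne')

end IsOptimalSupport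

/-! ### Expectations along the histories of a plan. -/

lemma Experiment.expect_indicator_singleton (e : Experiment Ω) (p : Belief Ω) :
    e.expect (Set.indicator {p} fun _ => 1) = e.weight p := by
  classical
  simp only [Experiment.expect, Set.indicator_apply, Set.mem_singleton_iff, mul_ite, mul_one,
    mul_zero, Finset.sum_ite_eq', Experiment.supp, Finsupp.mem_support_iff]
  split_ifs with h
  · rfl
  · exact (not_not.1 h).symm

namespace Plan

/-- The expectation of a function of the history after `n` steps. -/
def expectAt (φ : Plan Ω) (μ : Belief Ω) (n : ℕ) (g : History Ω → ℝ) : ℝ :=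
  ∑ ξ ∈ φ.histories μ n, ξ.prob * g ξ

/-- The conditional expectation of the value of `g` one step later. -/
def next (φ : Plan Ω) (g : History Ω → ℝ) (ξ : History Ω) : ℝ :=
  (φ ξ).expect fun p => g (ξ.step (φ ξ) p)

variable {φ : Plan Ω} {μ : Belief Ω} {n : ℕ}

lemma mem_histories_succ {ξ' : History Ω} : ξ' ∈ φ.histories μ (n + 1) ↔
    ∃ ξ ∈ φ.histories μ n, ∃ p ∈ (φ ξ).supp, ξ.step (φ ξ) p = ξ' := by
  simp only [histories, Finset.mem_biUnion, Finset.mem_image]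

lemma expectAt_zero (g : History Ω → ℝ) : φ.expectAt μ 0 g = g (History.start μ) := by
  simp [expectAt, histories, History.prob]

lemma expectAt_succ (g : History Ω → ℝ) :
    φ.expectAt μ (n + 1) g = φ.expectAt μ n (φ.next g) := by
  classical
  simp only [expectAt, histories]
  rw [Finset.sum_biUnion]
  · refine Finset.sum_congr rfl fun ξ _ => ?_
    rw [Finset.sum_image fun p _ q _ h => by injection h, next, Experiment.expect, Finset.mul_sum]
    refine Finset.sum_congr rfl fun p _ => ?_
    rw [History.prob, mul_assoc]
  · intro ξ _ ξ' _ hne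
    refine Finset.disjoint_left.2 fun η h h' => hne ?_
    simp only [Finset.mem_image] at h h'
    obtain ⟨p, -, rfl⟩ := h
    obtain ⟨q, -, h⟩ := h'
    injection h with h
    exact h.symm

lemma prob_pos {ξ : History Ω} (hξ : ξ ∈ φ.histories μ n) : 0 < ξ.prob := by
  induction n generalizing ξ with
  | zero =>
    rw [histories, Finset.mem_singleton] at hξ
    simp [hξ, History.prob]
  | succ n ih =>
    obtain ⟨ξ', hξ', p, hp, rfl⟩ := mem_histories_succ.1 hξ
    exact mul_pos (ih hξ') (Experiment.weight_pos hp)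

lemma expectAt_mono {f g : History Ω → ℝ} (h : ∀ ξ ∈ φ.histories μ n, f ξ ≤ g ξ) :
    φ.expectAt μ n f ≤ φ.expectAt μ n g :=
  Finset.sum_le_sum fun ξ hξ => mul_le_mul_of_nonneg_left (h ξ hξ) (prob_pos hξ).le

lemma expectAt_congr {f g : History Ω → ℝ} (h : ∀ ξ ∈ φ.histories μ n, f ξ = g ξ) :
    φ.expectAt μ n f = φ.expectAt μ n g :=
  Finset.sum_congr rfl fun ξ hξ => by rw [h ξ hξ]

lemma expectAt_nonneg {f : History Ω → ℝ} (h : ∀ ξ ∈ φ.histories μ n, 0 ≤ f ξ) :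
    0 ≤ φ.expectAt μ n f :=
  Finset.sum_nonneg fun ξ hξ => mul_nonneg (prob_pos hξ).le (h ξ hξ)

lemma expectAt_sub (f g : History Ω → ℝ) :
    φ.expectAt μ n (fun ξ => f ξ - g ξ) = φ.expectAt μ n f - φ.expectAt μ n g := by
  simp only [expectAt, mul_sub, Finset.sum_sub_distrib]

lemma expectAt_const_mul (c : ℝ) (f : History Ω → ℝ) :
    φ.expectAt μ n (fun ξ => c * f ξ) = c * φ.expectAt μ n f := by
  rw [expectAt, expectAt, Finset.mul_sum]
  exact Finset.sum_congr rfl fun ξ _ => by ring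

lemma expectAt_const (c : ℝ) : φ.expectAt μ n (fun _ => c) = c := by
  induction n with
  | zero => rw [expectAt_zero]
  | succ n ih =>
    rw [expectAt_succ, show φ.next (fun _ => c) = fun _ => c from
      funext fun ξ => Experiment.expect_const _ c, ih]

lemma probBelief_eq_expectAt (O : Set (Belief Ω)) :
    φ.probBelief μ n O = φ.expectAt μ n fun ξ => O.indicator (fun _ => 1) ξ.last := by
  refine Finset.sum_congr rfl fun ξ _ => ?_
  by_cases h : ξ.last ∈ O <;> simp [h]

/-- The distribution of the belief after `n` steps. -/
lemma exists_distribution {F : Set (Experiment Ω)} (hφ : φ ∈ finitePersuasions F μ n) :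
    ∃ d : Experiment Ω, d.mean = μ ∧ (∀ f, d.expect f = φ.expectAt μ n fun ξ => f ξ.last) ∧
      ∀ ξ ∈ φ.histories μ n, ξ.prob ≤ d.weight ξ.last := by
  -- The belief process is a martingale.
  have hmean : ∀ ω, ∀ i ≤ n, φ.expectAt μ i (fun ξ => (ξ.last : Ω → ℝ) ω) = (μ : Ω → ℝ) ω := by
    intro ω i
    induction i with
    | zero => intro _; rw [expectAt_zero]; rfl
    | succ i ih =>
      intro hi
      rw [← ih (by omega), expectAt_succ]
      refine expectAt_congr fun ξ hξ => ?_
      exact Experiment.mean_eq_iff.1 (hφ i hi ξ hξ).2 ω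
  have h1 : ∑ ξ : φ.histories μ n, (ξ : History Ω).prob = 1 := by
    rw [Finset.sum_coe_sort (φ.histories μ n) History.prob]
    simpa [expectAt] using expectAt_const (φ := φ) (μ := μ) (n := n) 1
  let d := Experiment.ofSum (fun ξ : φ.histories μ n => (ξ : History Ω).prob) (fun ξ => ξ.1.last)
    (fun ξ => (prob_pos ξ.2).le) h1
  have hd : ∀ f, d.expect f = φ.expectAt μ n fun ξ => f ξ.last := fun f => by
    rw [Experiment.expect_ofSum,
      Finset.sum_coe_sort (φ.histories μ n) fun ξ => ξ.prob * f ξ.last, expectAt]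
  refine ⟨d, Experiment.mean_eq_iff.2 fun ω => (hd _).trans (hmean ω n le_rfl), hd,
    fun ξ hξ => ?_⟩
  rw [← Experiment.expect_indicator_singleton, hd, expectAt]
  have := Finset.single_le_sum (f := fun η : History Ω =>
    η.prob * Set.indicator {ξ.last} (fun _ => (1 : ℝ)) η.last) (s := φ.histories μ n)
    (fun η hη => mul_nonneg (prob_pos hη).le (Set.indicator_nonneg (fun _ _ => zero_le_one) _)) hξ
  simpa using this

end Plan

lemma infinitePersuasions_subset (F : Set (Experiment Ω)) (μ : Belief Ω) (n : ℕ) :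
    infinitePersuasions F μ ⊆ finitePersuasions F μ n :=
  fun _ hφ i _ => hφ i

lemma feasibleAt_trivial {F : Set (Experiment Ω)} (hT : trivialExperiments Ω ⊆ F) (p : Belief Ω) :
    Experiment.trivial p ∈ feasibleAt F p :=
  ⟨hT ⟨p, rfl⟩, Experiment.mean_trivial p⟩

/-! ### Finite-horizon reaching probabilities. -/

/-- The largest probability with which the belief can be brought from `p` into `O` in `n` steps. -/
def reach (F : Set (Experiment Ω)) (O : Set (Belief Ω)) : ℕ → Belief Ω → ℝ
  | 0 => O.indicator fun _ => 1
  | n + 1 => fun p => sSup {x | ∃ e ∈ feasibleAt F p, x = e.expect (reach F O n)}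

section reach

variable {F : Set (Experiment Ω)} {O : Set (Belief Ω)}

lemma reach_succ_le (hT : trivialExperiments Ω ⊆ F) {n : ℕ} {p : Belief Ω} {c : ℝ}
    (h : ∀ e ∈ feasibleAt F p, e.expect (reach F O n) ≤ c) : reach F O (n + 1) p ≤ c := by
  refine csSup_le ⟨_, _, feasibleAt_trivial hT p, rfl⟩ ?_
  rintro _ ⟨e, he, rfl⟩
  exact h e he

lemma reach_le_one (hT : trivialExperiments Ω ⊆ F) (n : ℕ) (p : Belief Ω) :
    reach F O n p ≤ 1 := by
  induction n generalizing p with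
  | zero => exact Set.indicator_le_self' (fun _ _ => zero_le_one) p
  | succ n ih => exact reach_succ_le hT fun e _ =>
      (Experiment.expect_mono fun q _ => ih q).trans_eq (e.expect_const 1)

lemma expect_reach_le (hT : trivialExperiments Ω ⊆ F) (n : ℕ) {e : Experiment Ω}
    {p : Belief Ω} (he : e ∈ feasibleAt F p) : e.expect (reach F O n) ≤ reach F O (n + 1) p := by
  refine le_csSup ⟨1, ?_⟩ ⟨e, he, rfl⟩
  rintro _ ⟨e', -, rfl⟩
  exact (Experiment.expect_mono fun q _ => reach_le_one hT n q).trans_eq (e'.expect_const 1)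

lemma exists_lt_expect_reach (hT : trivialExperiments Ω ⊆ F) {n : ℕ} {p : Belief Ω} {c : ℝ}
    (hc : c < reach F O (n + 1) p) : ∃ e ∈ feasibleAt F p, c < e.expect (reach F O n) := by
  by_contra! h
  exact absurd (reach_succ_le hT h) (not_le.2 hc)

lemma reach_mono (hT : trivialExperiments Ω ⊆ F) (p : Belief Ω) :
    Monotone fun n => reach F O n p :=
  monotone_nat_of_le_succ fun n => by
    simpa using expect_reach_le (O := O) hT n (feasibleAt_trivial hT p)

lemma reach_nonneg (hT : trivialExperiments Ω ⊆ F) (n : ℕ) (p : Belief Ω) :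
    0 ≤ reach F O n p :=
  (Set.indicator_nonneg (fun _ _ => zero_le_one) p).trans (reach_mono hT p (Nat.zero_le n))

/-- Near-maximising experiments at points tending to p subconverge to an experiment in F that
spreads p, and the induction hypothesis controls their expectations. Closedness of O is the base
case. -/
lemma upperSemicontinuous_reach (hT : trivialExperiments Ω ⊆ F) (hF : IsClosedBounded F)
    (hO : IsClosed O) (n : ℕ) : UpperSemicontinuous (reach F O n) := by
  induction n with
  | zero => exact hO.upperSemicontinuous_indicator zero_le_one
  | succ n ih =>
    intro p y hy
    by_contra hnot
    obtain ⟨x, hx, hxy⟩ := exists_seq_forall_of_frequently (not_eventually.1 hnot)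
    obtain ⟨c, hc, hcy⟩ := exists_between hy
    choose e he hce using fun k =>
      exists_lt_expect_reach (O := O) hT (hcy.trans_le (not_lt.1 (hxy k)))
    obtain ⟨e', he'F, φ, hφ, husc, hcont⟩ := hF.exists_subseq fun k => (he k).1
    have hmean : e'.mean = p := by
      refine Experiment.mean_eq_iff.2 fun ω => ?_
      refine tendsto_nhds_unique (hcont _ (continuous_belief_apply ω)) ?_
      simp only [fun k => Experiment.mean_eq_iff.1 (he k).2 ω]
      exact ((continuous_belief_apply ω).tendsto p).comp (hx.comp hφ.tendsto_atTop)
    obtain ⟨k, hk⟩ := (husc _ ih c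
      ((expect_reach_le hT n ⟨he'F, hmean⟩).trans_lt hc)).exists
    exact lt_asymm hk (hce _)

/-- More than `n` steps increase the probability of reaching `O` only by `O(1 / n)`, because every
nontrivial step uses up entropy. -/
lemma reach_le_add (hT : trivialExperiments Ω ⊆ F) {δ : ℝ} (hδ : 0 < δ)
    (hgap : ∀ e ∈ F \ trivialExperiments Ω, e.expect entropy ≤ entropy e.mean - δ) (n m : ℕ)
    (p : Belief Ω) : reach F O m p ≤ reach F O n p + entropy p / (δ * (n + 1)) := by
  induction n generalizing m p with
  | zero =>
    induction m with
    | zero =>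
      have := entropy_nonneg p
      have : 0 ≤ entropy p / (δ * ((0 : ℕ) + 1)) := by positivity
      linarith
    | succ m ihm =>
      refine reach_succ_le hT fun e he => ?_
      by_cases htriv : e ∈ trivialExperiments Ω
      · obtain ⟨q, rfl⟩ := htriv
        have hq : q = p := by simpa using he.2
        rw [Experiment.expect_trivial, hq]
        exact ihm
      · have h1 := hgap e ⟨he.1, htriv⟩
        have h2 := Experiment.expect_nonneg (e := e) fun q _ => entropy_nonneg q
        -- A nontrivial first step needs entropy at least δ, so the error term already exceeds any
        -- probability.
        have h3 : 1 ≤ entropy p / (δ * ((0 : ℕ) + 1)) := by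
          rw [he.2] at h1
          rw [le_div_iff₀ (by positivity)]
          push_cast
          linarith
        have h4 := reach_nonneg (O := O) hT 0 p
        have h5 := (expect_reach_le (O := O) hT m he).trans (reach_le_one hT (m + 1) p)
        linarith
  | succ n ihn =>
    induction m with
    | zero =>
      have := entropy_nonneg p
      have : 0 ≤ entropy p / (δ * ((n + 1 : ℕ) + 1)) := by positivity
      have := reach_mono (O := O) hT p (Nat.zero_le (n + 1))
      simp only at this
      linarith
    | succ m ihm =>
      refine reach_succ_le hT fun e he => ?_
      by_cases htriv : e ∈ trivialExperiments Ω
      · obtain ⟨q, rfl⟩ := htriv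
        have hq : q = p := by simpa using he.2
        rw [Experiment.expect_trivial, hq]
        exact ihm
      -- If the entropy is at least δ(n + 2), the error term is at least 1. Otherwise (H − δ)/(δ(n +
      -- 1)) ≤ H/(δ(n + 2)), so the entropy lost in the first step pays for the shorter horizon.
      · rcases le_total (δ * ((n + 1 : ℕ) + 1)) (entropy p) with hle | hle
        · have h3 : 1 ≤ entropy p / (δ * ((n + 1 : ℕ) + 1)) := by
            rwa [le_div_iff₀ (by positivity), one_mul]
          have h4 := reach_nonneg (O := O) hT (n + 1) p
          have h5 := (expect_reach_le (O := O) hT m he).trans (reach_le_one hT (m + 1) p)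
          linarith
        · have h1 := hgap e ⟨he.1, htriv⟩
          rw [he.2] at h1
          have h2 : e.expect (reach F O m) ≤
              e.expect (reach F O n) + e.expect entropy * (δ * (n + 1))⁻¹ := by
            rw [← Experiment.expect_mul_const, ← Experiment.expect_add]
            exact Experiment.expect_mono fun q _ => ihn m q
          have h3 := expect_reach_le (O := O) hT n he
          have hpos : 0 < δ * ((n : ℝ) + 1) := by positivity
          have h4 : e.expect entropy * (δ * ((n : ℝ) + 1))⁻¹ ≤
              (entropy p - δ) * (δ * (n + 1))⁻¹ :=
            mul_le_mul_of_nonneg_right h1 (inv_nonneg.2 hpos.le)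
          have h5 : (entropy p - δ) * (δ * ((n : ℝ) + 1))⁻¹ ≤
              entropy p / (δ * ((n + 1 : ℕ) + 1)) := by
            rw [← div_eq_mul_inv, div_le_div_iff₀ hpos (by positivity)]
            push_cast at hle ⊢
            have := mul_le_mul_of_nonneg_left hle hδ.le
            linarith
          linarith

/-- Dynamic programming: the expected best reaching probability over the remaining steps cannot
increase along a plan. -/
lemma probBelief_le_reach (hT : trivialExperiments Ω ⊆ F) {φ : Plan Ω} {μ : Belief Ω} {n : ℕ}
    (hφ : φ ∈ finitePersuasions F μ n) : φ.probBelief μ n O ≤ reach F O n μ := by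
  have key : ∀ i j, i + j = n → φ.expectAt μ i (fun ξ => reach F O j ξ.last) ≤ reach F O n μ := by
    intro i
    induction i with
    | zero =>
      intro j hj
      rw [Plan.expectAt_zero, ← hj, Nat.zero_add]
      rfl
    | succ i ih =>
      intro j hj
      refine le_trans ?_ (ih (j + 1) (by omega))
      rw [Plan.expectAt_succ]
      exact Plan.expectAt_mono fun ξ hξ => expect_reach_le hT j (hφ i (by omega) ξ hξ)
  rw [Plan.probBelief_eq_expectAt]
  exact key n 0 rfl

end reach

lemma Experiment.notMem_trivialExperiments {e : Experiment Ω}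
    (he : e ≠ Experiment.trivial e.mean) : e ∉ trivialExperiments Ω := by
  rintro ⟨q, rfl⟩
  rw [Experiment.mean_trivial] at he
  exact he rfl

/-! ### From implementability to a family of nontrivial experiments. -/

/-- An implementable closed set is reached through a set on which `F` has nontrivial experiments. -/
theorem Implementable.exists_closed_family {F : Set (Experiment Ω)} {μ : Belief Ω}
    {O : Set (Belief Ω)} (hT : trivialExperiments Ω ⊆ F) (hF : IsClosedBounded F)
    (hgap : HasEntropyGap F) (hO : IsClosed O) (h : Implementable F μ O) :
    ∃ (D : Set (Belief Ω)) (F_D : Set (Experiment Ω)), F_D ⊆ F \ trivialExperiments Ω ∧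
      μ ∈ D ∪ O ∧ (∀ p ∈ D, (F_D ∩ feasibleAt F p).Nonempty) ∧
      (⋃ e ∈ F_D, (e.supp : Set (Belief Ω))) ⊆ D ∪ O := by
  obtain ⟨δ, hδ, hgap⟩ := hgap
  obtain ⟨C, hC⟩ := exists_bound_of_upperSemicontinuous
    (continuous_entropy (Ω := Ω)).upperSemicontinuous
  let W : Belief Ω → ℝ := fun p => ⨆ n, reach F O n p
  have hbdd : ∀ p, BddAbove (Set.range fun n => reach F O n p) := by
    rintro p
    refine ⟨1, ?_⟩
    rintro _ ⟨n, rfl⟩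
    exact reach_le_one hT n p
  have hleW : ∀ n p, reach F O n p ≤ W p := fun n p => le_ciSup (hbdd p) n
  have hW1 : ∀ p, W p ≤ 1 := fun p => ciSup_le fun n => reach_le_one hT n p
  have hWle : ∀ n p, W p ≤ reach F O n p + C / (δ * (n + 1)) := fun n p => ciSup_le fun m =>
    (reach_le_add hT hδ hgap n m p).trans
      (add_le_add_right (div_le_div_of_nonneg_right (hC p) (by positivity)) _)
  have hWusc : UpperSemicontinuous W := by
    intro p y hy
    obtain ⟨n, hn⟩ := exists_nat_gt (2 * C / (δ * (y - W p)))
    have hpos : 0 < y - W p := sub_pos.2 hy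
    have hsmall : C / (δ * (n + 1)) < (y - W p) / 2 := by
      rw [div_lt_iff₀ (by positivity)] at hn ⊢
      have : 0 < δ * (y - W p) := by positivity
      nlinarith
    filter_upwards [upperSemicontinuous_reach hT hF hO n p ((y + W p) / 2)
      (by linarith [hleW n p])] with q hq
    linarith [hWle n q]
  let D : Set (Belief Ω) := {p | W p = 1} \ O
  have hDO : ∀ p, W p = 1 → p ∈ D ∪ O := fun p hp => by
    by_cases hpO : p ∈ O
    · exact Or.inr hpO
    · exact Or.inl ⟨hp, hpO⟩
  refine ⟨D, {e | e ∈ F \ trivialExperiments Ω ∧ (e.supp : Set (Belief Ω)) ⊆ D ∪ O},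
    fun e he => he.1, hDO μ ?_, ?_, Set.iUnion₂_subset fun e he => he.2⟩
  · refine le_antisymm (hW1 μ) (le_of_forall_pos_lt_add fun ε hε => ?_)
    obtain ⟨n, φ, hφ, hlt⟩ := h ε hε
    linarith [probBelief_le_reach (O := O) hT hφ, hleW n μ]
  · rintro p ⟨hp, hpO⟩
    have hstep : ∀ k : ℕ, ∃ e ∈ feasibleAt F p, e ∉ trivialExperiments Ω ∧
        1 - 1 / ((k : ℝ) + 1) < e.expect W := by
      intro k
      have hk : 0 < 1 / ((k : ℝ) + 1) := by positivity
      have hk1 : 1 / ((k : ℝ) + 1) ≤ 1 := by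
        rw [div_le_one (by positivity)]
        linarith [(Nat.cast_nonneg k : (0 : ℝ) ≤ k)]
      have hex : ∃ n, 1 - 1 / ((k : ℝ) + 1) < reach F O n p :=
        exists_lt_of_lt_ciSup (show 1 - 1 / ((k : ℝ) + 1) < W p by rw [hp]; linarith)
      classical
      -- At the least sufficient horizon the first experiment cannot be trivial, since a trivial
      -- step would leave a shorter sufficient horizon. Horizon 0 is excluded because p lies outside
      -- O.
      obtain ⟨n, hn, hmin⟩ : ∃ n, 1 - 1 / ((k : ℝ) + 1) < reach F O n p ∧
          ∀ m < n, ¬ 1 - 1 / ((k : ℝ) + 1) < reach F O m p :=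
        ⟨Nat.find hex, Nat.find_spec hex, fun m hm => Nat.find_min hex hm⟩
      cases n with
      | zero =>
        simp only [reach, Set.indicator_of_notMem hpO] at hn
        linarith
      | succ n =>
        obtain ⟨e, he, hlt⟩ := exists_lt_expect_reach hT hn
        refine ⟨e, he, ?_, hlt.trans_le (Experiment.expect_mono fun q _ => hleW n q)⟩
        rintro ⟨q, rfl⟩
        have hq : q = p := by simpa using he.2
        rw [Experiment.expect_trivial, hq] at hlt
        exact hmin n (Nat.lt_succ_self n) hlt
    choose e he hnt hlt using hstep
    obtain ⟨e', he'F, φ, hφ, husc, hcont⟩ := hF.exists_subseq fun k => (he k).1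
    have hmean : e'.mean = p := by
      refine Experiment.mean_eq_iff.2 fun ω => ?_
      refine tendsto_nhds_unique (hcont _ (continuous_belief_apply ω)) ?_
      simp only [fun k => Experiment.mean_eq_iff.1 (he k).2 ω]
      exact tendsto_const_nhds
    -- The gap δ survives the limit because entropy is continuous; this makes the limit nontrivial.
    have hent : e'.expect entropy ≤ entropy p - δ := by
      refine le_of_tendsto (hcont _ continuous_entropy) (Eventually.of_forall fun k => ?_)
      have := hgap _ ⟨(he (φ k)).1, hnt (φ k)⟩
      rwa [(he (φ k)).2] at this
    have hval : 1 ≤ e'.expect W := by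
      by_contra! hlt1
      obtain ⟨c, hc, hc1⟩ := exists_between hlt1
      have hlim : Tendsto (fun k => 1 - 1 / (((φ k : ℕ) : ℝ) + 1)) atTop (𝓝 (1 - 0)) :=
        tendsto_const_nhds.sub (tendsto_one_div_add_atTop_nhds_zero_nat.comp hφ.tendsto_atTop)
      rw [sub_zero] at hlim
      obtain ⟨k, hk1, hk2⟩ := ((husc W hWusc c hc).and
        (hlim.eventually (lt_mem_nhds hc1))).exists
      exact lt_asymm hk1 (hk2.trans (hlt _))
    refine ⟨e', ⟨⟨he'F, ?_⟩, fun q hq =>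
      hDO q (Experiment.eq_one_of_one_le_expect hW1 hval hq)⟩, he'F, hmean⟩
    rintro ⟨q, rfl⟩
    rw [Experiment.mean_trivial] at hmean
    rw [Experiment.expect_trivial, hmean] at hent
    linarith

/-! ### Termination and value of infinite persuasions. -/

lemma History.last_stay_iterate (ξ : History Ω) (l : ℕ) :
    (History.stay^[l] ξ).last = ξ.last := by
  induction l with
  | zero => rfl
  | succ l ih => rw [Function.iterate_succ_apply']; exact ih

namespace Plan

variable {φ : Plan Ω} {μ : Belief Ω} {F : Set (Experiment Ω)} {n : ℕ}

/-- The expected utility from the histories of length `n` after which the plan has terminated. -/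
def terminatedValue (φ : Plan Ω) (μ : Belief Ω) (v : Belief Ω → ℝ) (n : ℕ) : ℝ :=
  φ.expectAt μ n (Set.indicator {ξ | φ.TerminatesAfter ξ} fun ξ => v ξ.last)

lemma value_eq_iSup_terminatedValue (v : Belief Ω → ℝ) :
    φ.value μ v = ⨆ n, φ.terminatedValue μ v n := by
  refine iSup_congr fun n => Finset.sum_congr rfl fun ξ _ => ?_
  by_cases h : φ.TerminatesAfter ξ <;> simp [h]

lemma TerminatesAfter.stay {ξ : History Ω} (h : φ.TerminatesAfter ξ) :
    φ.TerminatesAfter ξ.stay :=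
  fun l => h (l + 1)

lemma stay_mem_histories {ξ : History Ω} (hξ : ξ ∈ φ.histories μ n)
    (h : φ ξ = Experiment.trivial ξ.last) : ξ.stay ∈ φ.histories μ (n + 1) :=
  mem_histories_succ.2 ⟨ξ, hξ, ξ.last, by simp [h], by rw [h, History.stay]⟩

lemma next_eq_of_eq_trivial {ξ : History Ω} (h : φ ξ = Experiment.trivial ξ.last)
    (g : History Ω → ℝ) : φ.next g ξ = g ξ.stay := by
  rw [next, h, Experiment.expect_trivial, History.stay]

lemma TerminatesAfter.exists_later {ξ : History Ω} (hξ : ξ ∈ φ.histories μ n)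
    (h : φ.TerminatesAfter ξ) (k : ℕ) :
    ∃ ξ' ∈ φ.histories μ (n + k), ξ'.last = ξ.last ∧ ξ'.prob = ξ.prob := by
  induction k generalizing n ξ with
  | zero => exact ⟨ξ, hξ, rfl, rfl⟩
  | succ k ih =>
    obtain ⟨ξ', hξ', hlast, hprob⟩ := ih (stay_mem_histories hξ (h 0)) h.stay
    refine ⟨ξ', by rwa [show n + (k + 1) = n + 1 + k by omega], hlast, ?_⟩
    rw [hprob, History.stay, History.prob, Experiment.weight_trivial, mul_one]

/-- A terminated history persists with its probability and last belief; newly terminated ones add a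
nonnegative amount. -/
lemma terminatedValue_monotone {v : Belief Ω → ℝ} (hv : ∀ p, 0 ≤ v p) :
    Monotone (φ.terminatedValue μ v) := by
  refine monotone_nat_of_le_succ fun n => ?_
  rw [terminatedValue, terminatedValue, expectAt_succ]
  refine expectAt_mono fun ξ _ => ?_
  by_cases h : φ.TerminatesAfter ξ
  · rw [next_eq_of_eq_trivial (ξ := ξ) (h 0), Set.indicator_of_mem (by exact h),
      Set.indicator_of_mem (by exact h.stay)]
    exact le_rfl
  · rw [Set.indicator_of_notMem (by exact h)]
    exact Experiment.expect_nonneg fun p _ => Set.indicator_nonneg (fun _ _ => hv _) _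

lemma terminatedValue_le_expectAt {v : Belief Ω → ℝ} (hv : ∀ p, 0 ≤ v p) (n : ℕ) :
    φ.terminatedValue μ v n ≤ φ.expectAt μ n fun ξ => v ξ.last :=
  expectAt_mono fun ξ _ => Set.indicator_le_self' (fun _ _ => hv _) ξ

lemma terminatedValue_le_concaveClosure {v : Belief Ω → ℝ} (hv : ∀ p, 0 ≤ v p)
    (husc : UpperSemicontinuous v) (hφ : φ ∈ infinitePersuasions F μ) (n : ℕ) :
    φ.terminatedValue μ v n ≤ concaveClosure v μ := by
  obtain ⟨d, hd, hexp, -⟩ := exists_distribution (infinitePersuasions_subset F μ n hφ)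
  have := expect_le_concaveClosure husc d
  rw [hd, hexp] at this
  exact (terminatedValue_le_expectAt hv n).trans this

/-- A plan of maximal value terminates only at beliefs in the optimal support set. -/
lemma last_mem_of_terminatesAfter {v : Belief Ω → ℝ} {O : Set (Belief Ω)} (hv : ∀ p, 0 ≤ v p)
    (husc : UpperSemicontinuous v) (hO : IsOptimalSupport v μ O)
    (hφ : φ ∈ infinitePersuasions F μ) (hval : φ.value μ v = concaveClosure v μ)
    {ξ : History Ω} (hξ : ξ ∈ φ.histories μ n) (hξt : φ.TerminatesAfter ξ) : ξ.last ∈ O := by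
  -- The cap 1/2 keeps a below 1, so that the remaining mass can be renormalised even if the history
  -- has probability 1.
  obtain ⟨a, ha0, ha1, ha⟩ : ∃ a : ℝ, 0 < a ∧ a < 1 ∧ a ≤ ξ.prob :=
    ⟨min ξ.prob 2⁻¹, lt_min (prob_pos hξ) (by norm_num),
      (min_le_right _ _).trans_lt (by norm_num), min_le_left _ _⟩
  have h1a : 0 < 1 - a := sub_pos.2 ha1
  have hdec : ∀ k, ∃ g : Experiment Ω,
      (∀ ω, (μ : Ω → ℝ) ω = a * (ξ.last : Ω → ℝ) ω + (1 - a) * (g.mean : Ω → ℝ) ω) ∧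
      φ.terminatedValue μ v (n + k) ≤ a * v ξ.last + (1 - a) * g.expect v := by
    intro k
    obtain ⟨d, hd, hexp, hw⟩ := exists_distribution (infinitePersuasions_subset F μ (n + k) hφ)
    obtain ⟨ξ', hξ', hlast, hprob⟩ := hξt.exists_later hξ k
    have hle : a ≤ d.weight ξ.last := by
      rw [← hlast]
      exact (ha.trans_eq hprob.symm).trans (hw ξ' hξ')
    obtain ⟨g, hg⟩ := Experiment.exists_remainder d ha0 ha1 hle
    refine ⟨g, fun ω => ?_, ?_⟩
    · rw [Experiment.mean_apply, ← Experiment.mean_eq_iff.1 hd, hg]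
    · rw [← hg, hexp]
      exact terminatedValue_le_expectAt hv _
  choose g hgμ hgv using hdec
  -- The remainders may vary with k but their mean is fixed by μ, the stopping belief and a, so one
  -- optimal experiment f dominates them all.
  have hmean : ∀ k, (g k).mean = (g 0).mean := fun k => by
    refine DFunLike.ext _ _ fun ω => mul_left_cancel₀ h1a.ne' ?_
    have h1 := hgμ k ω
    have h2 := hgμ 0 ω
    linarith
  obtain ⟨f, hfm, hfv⟩ := exists_expect_eq_concaveClosure husc (g 0).mean
  obtain ⟨e, hmem, he⟩ := Experiment.exists_mix f ξ.last ha0 ha1.le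
  have hem : e.mean = μ := Experiment.mean_eq_iff.2 fun ω => by
    rw [he, hgμ 0, ← hfm, Experiment.mean_apply]
  have hopt : e.expect v = concaveClosure v μ := by
    refine le_antisymm ?_ ?_
    · rw [← hem]
      exact expect_le_concaveClosure husc e
    · rw [← hval, value_eq_iSup_terminatedValue]
      refine ciSup_le fun m => ?_
      refine (terminatedValue_monotone hv (Nat.le_add_left m n)).trans ((hgv m).trans ?_)
      rw [he, hfv, ← hmean m]
      exact add_le_add_right
        (mul_le_mul_of_nonneg_left (expect_le_concaveClosure husc (g m)) h1a.le) _
  exact (hO.2 μ hO.1 e hem).1 hopt hmem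

lemma expectAt_add (g : History Ω → ℝ) (k : ℕ) :
    φ.expectAt μ (n + k) g = φ.expectAt μ n (φ.next^[k] g) := by
  induction k generalizing g with
  | zero => rfl
  | succ k ih =>
    rw [Function.iterate_succ_apply, ← ih, ← expectAt_succ]
    rfl

/-! ### Entropy accounting along a plan. -/

section entropy

variable {δ : ℝ}

lemma expect_entropy_le (hδ : 0 < δ)
    (hgap : ∀ e ∈ F \ trivialExperiments Ω, e.expect entropy ≤ entropy e.mean - δ)
    {e : Experiment Ω} (he : e ∈ F) : e.expect entropy ≤ entropy e.mean := by
  by_cases ht : e ∈ trivialExperiments Ω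
  · obtain ⟨q, rfl⟩ := ht
    simp
  · linarith [hgap e ⟨he, ht⟩]

lemma antitone_iterate_next_entropy (hδ : 0 < δ)
    (hgap : ∀ e ∈ F \ trivialExperiments Ω, e.expect entropy ≤ entropy e.mean - δ)
    (hφ : φ ∈ infinitePersuasions F μ) {ξ : History Ω} (hξ : ξ ∈ φ.histories μ n) :
    Antitone fun k => φ.next^[k] (fun η => entropy η.last) ξ := by
  refine antitone_nat_of_succ_le fun k => ?_
  induction k generalizing n ξ with
  | zero =>
    have h := expect_entropy_le hδ hgap (hφ n ξ hξ).1
    rwa [(hφ n ξ hξ).2] at h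
  | succ k ih =>
    rw [Function.iterate_succ_apply', Function.iterate_succ_apply']
    refine Experiment.expect_mono fun p hp => ?_
    have h := ih (mem_histories_succ.2 ⟨ξ, hξ, p, hp, rfl⟩)
    rwa [Function.iterate_succ_apply'] at h

/-- Non-termination means that some nontrivial experiment is chosen after finitely many stays; the
stays keep the entropy, and that experiment costs δ. -/
lemma exists_entropy_drop
    (hgap : ∀ e ∈ F \ trivialExperiments Ω, e.expect entropy ≤ entropy e.mean - δ)
    (hφ : φ ∈ infinitePersuasions F μ) {ξ : History Ω} (hξ : ξ ∈ φ.histories μ n)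
    (hξt : ¬ φ.TerminatesAfter ξ) :
    ∃ k, φ.next^[k] (fun η => entropy η.last) ξ ≤ entropy ξ.last - δ := by
  simp only [TerminatesAfter, not_forall] at hξt
  obtain ⟨l, hl⟩ := hξt
  induction l generalizing n ξ with
  | zero =>
    obtain ⟨hF, hm⟩ := hφ n ξ hξ
    refine ⟨1, ?_⟩
    have h := hgap _ ⟨hF, Experiment.notMem_trivialExperiments (by rw [hm]; exact hl)⟩
    rwa [hm] at h
  | succ l ih =>
    by_cases ht : φ ξ = Experiment.trivial ξ.last
    · obtain ⟨k, hk⟩ := ih (stay_mem_histories hξ ht) hl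
      refine ⟨k + 1, ?_⟩
      rw [Function.iterate_succ_apply', next_eq_of_eq_trivial ht]
      exact hk
    · obtain ⟨hF, hm⟩ := hφ n ξ hξ
      refine ⟨1, ?_⟩
      have h := hgap _ ⟨hF, Experiment.notMem_trivialExperiments (by rw [hm]; exact ht)⟩
      rwa [hm] at h

/-- With probability close to one the plan has terminated after finitely many steps. -/
lemma exists_terminated_prob (hδ : 0 < δ)
    (hgap : ∀ e ∈ F \ trivialExperiments Ω, e.expect entropy ≤ entropy e.mean - δ)
    (hφ : φ ∈ infinitePersuasions F μ) {ε : ℝ} (hε : 0 < ε) :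
    ∃ n, 1 - ε < φ.terminatedValue μ (fun _ => 1) n := by
  by_contra! hcon
  have hdrop : ∀ n, ∃ N, φ.expectAt μ N (fun η => entropy η.last) ≤
      φ.expectAt μ n (fun η => entropy η.last) - δ * ε := by
    intro n
    have hk : ∀ ξ, ∃ k, ξ ∈ φ.histories μ n → ¬ φ.TerminatesAfter ξ →
        φ.next^[k] (fun η => entropy η.last) ξ ≤ entropy ξ.last - δ := by
      intro ξ
      by_cases h : ξ ∈ φ.histories μ n ∧ ¬ φ.TerminatesAfter ξ
      · obtain ⟨k, hk⟩ := exists_entropy_drop hgap hφ h.1 h.2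
        exact ⟨k, fun _ _ => hk⟩
      · exact ⟨0, fun h1 h2 => absurd ⟨h1, h2⟩ h⟩
    choose k hk using hk
    -- There are finitely many histories, so one waiting time serves them all; expected entropy
    -- never rises while waiting.
    refine ⟨n + (φ.histories μ n).sup k, ?_⟩
    rw [expectAt_add]
    have hle : φ.expectAt μ n (φ.next^[(φ.histories μ n).sup k] fun η => entropy η.last) ≤
        φ.expectAt μ n fun ξ => entropy ξ.last -
          δ * (1 - Set.indicator {ξ | φ.TerminatesAfter ξ} (fun _ => 1) ξ) := by
      refine expectAt_mono fun ξ hξ => ?_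
      have hanti := antitone_iterate_next_entropy hδ hgap hφ hξ
      by_cases h : φ.TerminatesAfter ξ
      · rw [Set.indicator_of_mem (by exact h), sub_self, mul_zero, sub_zero]
        exact hanti (Nat.zero_le _)
      · rw [Set.indicator_of_notMem (by exact h), sub_zero, mul_one]
        exact (hanti (Finset.le_sup hξ)).trans (hk ξ hξ h)
    rw [expectAt_sub, expectAt_const_mul, expectAt_sub, expectAt_const] at hle
    have := mul_le_mul_of_nonneg_left (hcon n) hδ.le
    rw [terminatedValue] at this
    linarith
  have hiter : ∀ j : ℕ, ∃ n, φ.expectAt μ n (fun η => entropy η.last) ≤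
      entropy μ - j * (δ * ε) := by
    intro j
    induction j with
    | zero => exact ⟨0, by rw [expectAt_zero]; simp [History.last]⟩
    | succ j ih =>
      obtain ⟨n, hn⟩ := ih
      obtain ⟨N, hN⟩ := hdrop n
      refine ⟨N, ?_⟩
      push_cast
      linarith
  obtain ⟨j, hj⟩ := exists_nat_gt (entropy μ / (δ * ε))
  obtain ⟨n, hn⟩ := hiter j
  rw [div_lt_iff₀ (by positivity)] at hj
  have := expectAt_nonneg (φ := φ) (μ := μ) (n := n) (f := fun η => entropy η.last)
    fun ξ _ => entropy_nonneg _
  linarith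

/-- A plan that is nontrivial outside `O` and trivial on `O` spends entropy for as long as it has
not reached `O`. -/
lemma probBelief_compl_le (hδ : 0 < δ)
    (hgap : ∀ e ∈ F \ trivialExperiments Ω, e.expect entropy ≤ entropy e.mean - δ)
    {O : Set (Belief Ω)} (hφ : φ ∈ infinitePersuasions F μ)
    (hin : ∀ n, ∀ ξ ∈ φ.histories μ n, ξ.last ∈ O → φ ξ = Experiment.trivial ξ.last)
    (hout : ∀ n, ∀ ξ ∈ φ.histories μ n, ξ.last ∉ O → φ ξ ∉ trivialExperiments Ω) (n : ℕ) :
    n * δ * φ.probBelief μ n Oᶜ ≤ entropy μ := by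
  have hanti : ∀ n, φ.probBelief μ (n + 1) Oᶜ ≤ φ.probBelief μ n Oᶜ := by
    intro n
    rw [probBelief_eq_expectAt, probBelief_eq_expectAt, expectAt_succ]
    refine expectAt_mono fun ξ hξ => ?_
    by_cases h : ξ.last ∈ O
    · rw [next_eq_of_eq_trivial (hin n ξ hξ h)]
      exact le_rfl
    · rw [Set.indicator_of_mem (by exact h)]
      exact (Experiment.expect_mono fun p _ =>
        Set.indicator_le_self' (fun _ _ => zero_le_one) p).trans_eq (Experiment.expect_const _ 1)
  have hent : ∀ n, φ.expectAt μ (n + 1) (fun ξ => entropy ξ.last) ≤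
      φ.expectAt μ n (fun ξ => entropy ξ.last) - δ * φ.probBelief μ n Oᶜ := by
    intro n
    rw [probBelief_eq_expectAt, expectAt_succ, ← expectAt_const_mul, ← expectAt_sub]
    refine expectAt_mono fun ξ hξ => ?_
    obtain ⟨hF, hm⟩ := hφ n ξ hξ
    by_cases h : ξ.last ∈ O
    · rw [next_eq_of_eq_trivial (hin n ξ hξ h), Set.indicator_of_notMem (by simpa using h)]
      simp [History.stay, History.last]
    · rw [Set.indicator_of_mem (by exact h), mul_one]
      have := hgap _ ⟨hF, hout n ξ hξ h⟩
      rwa [hm] at this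
  -- Each of the first n steps costs at least δ times the final probability of being outside O,
  -- since that probability is nonincreasing.
  have hsum : ∀ n : ℕ, φ.expectAt μ n (fun ξ => entropy ξ.last) +
      n * δ * φ.probBelief μ n Oᶜ ≤ entropy μ := by
    intro n
    induction n with
    | zero => rw [expectAt_zero]; simp [History.last]
    | succ n ih =>
      have h1 := hent n
      have h2 := mul_le_mul_of_nonneg_left (hanti n)
        (show (0 : ℝ) ≤ ((n + 1 : ℕ) : ℝ) * δ by positivity)
      push_cast at h2 ⊢
      linarith
  have := expectAt_nonneg (φ := φ) (μ := μ) (n := n) (f := fun η => entropy η.last)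
    fun ξ _ => entropy_nonneg _
  linarith [hsum n]

end entropy

end Plan

/-! ### From the family to an optimal plan, and from an optimal plan to implementability. -/

/-- The stationary plan that applies a nontrivial experiment of the family until it reaches `O` has
maximal value. -/
theorem IsOptimalSupport.exists_plan {F : Set (Experiment Ω)} {μ : Belief Ω}
    {O D : Set (Belief Ω)} {F_D : Set (Experiment Ω)} {v : Belief Ω → ℝ}
    (hO : IsOptimalSupport v μ O) (hT : trivialExperiments Ω ⊆ F) (hv : ∀ p, 0 ≤ v p)
    (husc : UpperSemicontinuous v) (hgap : HasEntropyGap F)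
    (hFD : F_D ⊆ F \ trivialExperiments Ω) (hμ : μ ∈ D ∪ O)
    (hD : ∀ p ∈ D, (F_D ∩ feasibleAt F p).Nonempty)
    (hsupp : (⋃ e ∈ F_D, (e.supp : Set (Belief Ω))) ⊆ D ∪ O) :
    ∃ φ ∈ infinitePersuasions F μ, φ.value μ v = concaveClosure v μ := by
  obtain ⟨δ, hδ, hgap⟩ := hgap
  have hex : ∀ p, ∃ e : Experiment Ω, (p ∈ O → e = Experiment.trivial p) ∧
      (p ∈ D → p ∉ O → e ∈ F_D ∩ feasibleAt F p) := by
    intro p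
    by_cases hp : p ∈ O
    · exact ⟨_, fun _ => rfl, fun _ h => absurd hp h⟩
    · by_cases hpD : p ∈ D
      · obtain ⟨e, he⟩ := hD p hpD
        exact ⟨e, fun h => absurd h hp, fun _ _ => he⟩
      · exact ⟨Experiment.trivial p, fun _ => rfl, fun h => absurd h hpD⟩
  choose c hcO hcD using hex
  let φ : Plan Ω := fun ξ => c ξ.last
  have hreach : ∀ n, ∀ ξ ∈ φ.histories μ n, ξ.last ∈ D ∪ O := by
    intro n
    induction n with
    | zero =>
      intro ξ hξ
      rw [Plan.histories, Finset.mem_singleton] at hξ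
      rw [hξ]
      exact hμ
    | succ n ih =>
      intro ξ hξ
      obtain ⟨ξ', hξ', p, hp, rfl⟩ := Plan.mem_histories_succ.1 hξ
      change p ∈ D ∪ O
      change p ∈ (c ξ'.last).supp at hp
      by_cases hlast : ξ'.last ∈ O
      · rw [hcO _ hlast, Experiment.supp_trivial, Finset.mem_singleton] at hp
        rw [hp]
        exact Or.inr hlast
      · exact hsupp (Set.mem_biUnion
          (hcD _ ((ih ξ' hξ').resolve_right hlast) hlast).1 hp)
  have hφ : φ ∈ infinitePersuasions F μ := by
    intro n ξ hξ
    change c ξ.last ∈ _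
    by_cases hlast : ξ.last ∈ O
    · rw [hcO _ hlast]
      exact feasibleAt_trivial hT _
    · exact (hcD _ ((hreach n ξ hξ).resolve_right hlast) hlast).2
  have hout : ∀ n, ∀ ξ ∈ φ.histories μ n, ξ.last ∉ O → φ ξ ∉ trivialExperiments Ω :=
    fun n ξ hξ hlast =>
      (hFD (hcD _ ((hreach n ξ hξ).resolve_right hlast) hlast).1).2
  have hterm : ∀ ξ, ξ.last ∈ O → φ.TerminatesAfter ξ := by
    intro ξ h l
    change c (History.stay^[l] ξ).last = _
    rw [History.last_stay_iterate, hcO _ h]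
  have hq := Plan.probBelief_compl_le hδ hgap hφ (fun _ ξ _ h => hcO ξ.last h) hout
  obtain ⟨l, hl⟩ := hO.exists_linear
  -- An experiment at μ supported in O is optimal, and v = l on its support.
  have hlμ : concaveClosure v μ = l μ := by
    obtain ⟨e, rfl, he⟩ := exists_experiment_of_mem_conv hO.1
    rw [← hO.expect_eq_of_supp_subset he, ← Experiment.expect_linear]
    exact Experiment.expect_congr fun q hq => hl q (he hq)
  have hlcont : Continuous fun p : Belief Ω => l p :=
    l.continuous_of_finiteDimensional.comp continuous_subtype_val
  obtain ⟨M, hM⟩ := exists_bound_of_upperSemicontinuous hlcont.upperSemicontinuous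
  refine ⟨φ, hφ, ?_⟩
  rw [Plan.value_eq_iSup_terminatedValue]
  have hle := Plan.terminatedValue_le_concaveClosure hv husc hφ
  refine le_antisymm (ciSup_le hle) (le_of_forall_pos_le_add fun η hη => ?_)
  -- Chosen so that the upper bound on l, times the probability H(μ)/(nδ) of missing O, is at most
  -- η.
  obtain ⟨n, hn⟩ := exists_nat_gt (max M 0 * entropy μ / (δ * η))
  have hn0 : (0 : ℝ) < n := lt_of_le_of_lt
    (div_nonneg (mul_nonneg (le_max_right _ _) (entropy_nonneg μ)) (by positivity)) hn
  have hsmall : max M 0 * φ.probBelief μ n Oᶜ ≤ η := by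
    rw [div_lt_iff₀ (by positivity)] at hn
    have h1 := mul_le_mul_of_nonneg_left (hq n) (le_max_right M 0)
    have h2 : n * δ * (max M 0 * φ.probBelief μ n Oᶜ) ≤ n * δ * η := by linarith
    exact le_of_mul_le_mul_left h2 (by positivity)
  have hlow : l μ - max M 0 * φ.probBelief μ n Oᶜ ≤ φ.terminatedValue μ v n := by
    obtain ⟨d, hd, hexp, -⟩ := Plan.exists_distribution (infinitePersuasions_subset F μ n hφ)
    rw [← hd, ← Experiment.expect_linear, hexp, hd, Plan.probBelief_eq_expectAt,
      ← Plan.expectAt_const_mul, ← Plan.expectAt_sub]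
    refine Plan.expectAt_mono fun ξ _ => ?_
    by_cases h : ξ.last ∈ O
    · rw [Set.indicator_of_notMem (by simpa using h), Set.indicator_of_mem (by exact hterm ξ h),
        mul_zero, sub_zero, hl _ h]
    · rw [Set.indicator_of_mem (by exact h), mul_one]
      have h1 := hM ξ.last
      have h2 := le_max_left M 0
      have h3 : 0 ≤ Set.indicator {ξ | φ.TerminatesAfter ξ} (fun ξ => v ξ.last) ξ :=
        Set.indicator_nonneg (fun _ _ => hv _) _
      linarith
  have hup := le_ciSup (f := φ.terminatedValue μ v)
    ⟨concaveClosure v μ, by rintro _ ⟨n, rfl⟩; exact hle n⟩ n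
  linarith

/-- A set is implementable if some infinite sequential persuasion attains the concave closure. -/
theorem IsOptimalSupport.implementable {F : Set (Experiment Ω)} {μ : Belief Ω}
    {O : Set (Belief Ω)} {v : Belief Ω → ℝ} (hO : IsOptimalSupport v μ O) (hv : ∀ p, 0 ≤ v p)
    (husc : UpperSemicontinuous v) (hgap : HasEntropyGap F) {φ : Plan Ω}
    (hφ : φ ∈ infinitePersuasions F μ) (hval : φ.value μ v = concaveClosure v μ) :
    Implementable F μ O := by
  obtain ⟨δ, hδ, hgap⟩ := hgap
  intro ε hε
  obtain ⟨n, hn⟩ := Plan.exists_terminated_prob hδ hgap hφ hε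
  refine ⟨n, φ, infinitePersuasions_subset F μ n hφ, hn.trans_le ?_⟩
  rw [Plan.probBelief_eq_expectAt]
  refine Plan.expectAt_mono fun ξ hξ => ?_
  by_cases h : φ.TerminatesAfter ξ
  · rw [Set.indicator_of_mem (by exact h), Set.indicator_of_mem
      (Plan.last_mem_of_terminatesAfter hv husc hO hφ hval hξ h)]
  · rw [Set.indicator_of_notMem (by exact h)]
    exact Set.indicator_nonneg (fun _ _ => zero_le_one) _

end

end SeqPersuasion

open SeqPersuasion
theorem mainTheorem2 {Ω : Type*} [Fintype Ω] (μ : Belief Ω) (F : Set (Experiment Ω))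
    (hT : trivialExperiments Ω ⊆ F) (v : Belief Ω → ℝ) (hv_nonneg : ∀ p, 0 ≤ v p)
    (hv_usc : UpperSemicontinuous v) (hF_closed : IsClosedBounded F)
    (hF_entropy : HasEntropyGap F) :
    (∃ O : Set (Belief Ω), IsOptimalSupport v μ O) ∧
    ∀ O : Set (Belief Ω), IsOptimalSupport v μ O →
      List.TFAE [
        Implementable F μ O,
        ∃ (D : Set (Belief Ω)) (F_D : Set (Experiment Ω)),
          F_D ⊆ F \ trivialExperiments Ω ∧
          μ ∈ D ∪ O ∧
          (∀ p ∈ D, (F_D ∩ feasibleAt F p).Nonempty) ∧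
          (⋃ e ∈ F_D, (e.supp : Set (Belief Ω))) ⊆ D ∪ O,
        ∃ φ ∈ infinitePersuasions F μ, φ.value μ v = concaveClosure v μ] := by
  refine ⟨exists_isOptimalSupport hv_usc μ, fun O hO => ?_⟩
  tfae_have 1 → 2 :=
    fun h => h.exists_closed_family hT hF_closed hF_entropy (hO.isClosed hv_usc)
  tfae_have 2 → 3 := fun ⟨_, _, hFD, hμ, hD, hsupp⟩ =>
    hO.exists_plan hT hv_nonneg hv_usc hF_entropy hFD hμ hD hsupp
  tfae_have 3 → 1 := fun ⟨_, hφ, hval⟩ =>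
    hO.implementable hv_nonneg hv_usc hF_entropy hφ hval
  tfae_finish
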